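/- **Setting.** Let $n\ge 1$, $A\in\mathbb R^{n\times n}$, $b,c,K\in\mathbb R^n$ with $(A,b)$ controllable and $A_m=A-bK^\top$ Hurwitz. Put $H_o(s)=(sI-A_m)^{-1}b$ and $k_g=1/(c^\top H_o(0))$. Let $C(s)$ be a stable, strictly proper rational transfer function with $C(0)=1$. Let $Q$ be symmetric positive definite, $P$ the solution of $A_m^\top P+PA_m=-Q$, and $\Gamma_c>0$. Let $\Theta\subset\mathbb R^n$ be compact and convex, let $\theta:[0,\infty)\to\Theta$ be continuously differentiable with $\|\dot\theta(t)\|\le d_\theta$ for all $t\ge0$ (Euclidean norm), and let $r$ be a bounded continuous signal on $[0,\infty)$. Let $x_0\in\mathbb R^n$ and $\hat\theta_0\in\Theta$. *Adaptive closed loop.* The signals $x,u,\hat x,\hat\theta$ satisfy, for $t\ge 0$, $$\dot x=Ax+b\,(u-\theta^\top(t)x),\qquad u=-K^\top x+u_2,\qquad u_2(s)=C(s)\big(\bar r(s)+k_g r(s)\big),\qquad \bar r=\hat\theta^\top x,$$ $$\dot{\hat x}=A_m\hat x-b\,\hat\theta^\top x+b\,u_2,\qquad \dot{\hat\theta}=\Gamma_c\,\mathrm{Proj}\big(\hat\theta,\;x\,(\hat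 x-x)^\top Pb\big),$$ with $x(0)=\hat x(0)=x_0$ and $\hat\theta(0)=\hat\theta_0$. Here $\mathrm{Proj}(p,y)$ is the Euclidean nearest point to $y$ in the tangent cone of $\Theta$ at $p$ (the adaptive law is understood in the sense of Carathéodory), and the filter $C(s)$ starts from zero initial conditions. *Reference system.* The signals $x_{ref},u_{ref}$ satisfy the same plant equation $\dot x_{ref}=Ax_{ref}+b\,(u_{ref}-\theta^\top(t)x_{ref})$, $x_{ref}(0)=x_0$, with $$u_{ref}(s)=C(s)\big(k_g r(s)+\eta(s)\big)-K^\top x_{ref}(s),\qquad \eta(t)=\theta^\top(t)x_{ref}(t).$$ *Norms and constants.* For a signal, $\|\xi\|_{\mathcal L_\infty}=\max_i\sup_{t\ge0}|\xi_i(t)|$. For a stable proper system, $\|H\|_{\mathcal L_1}=\max_i\sum_j\|H_{ij}\|_{\mathcal L_1}$, where the $\mathcal L_1$ gain of a scalar system is the total mass $|g_0|+\int_0^\infty|h(t)|\,dt$ of its impulse response $g_0\delta+h$. Put $\theta_{\max}=\max_{\theta\in\Theta}\sum_i|\theta_i|$ and $$\theta_m=\max_{\theta\in\Theta}\sum_{i=1}^n4\theta_i^2+2\,\frac{d_\theta\,\lambda_{\max}(P)}{\lambda_{\min}(Q)}\,\max_{\theta\in\Theta}\|\theta\|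 .$$ **Theorem.** Assume the $\mathcal L_1$-gain requirement $\|H_o(s)(C(s)-1)\|_{\mathcal L_1}\,\theta_{\max}<1$. Then $$\|x-x_{ref}\|_{\mathcal L_\infty}\le\gamma_3=\frac{\|C(s)\|_{\mathcal L_1}}{1-\|H_o(s)(1-C(s))\|_{\mathcal L_1}\,\theta_{\max}}\sqrt{\frac{\theta_m}{\lambda_{\min}(P)\,\Gamma_c}} .$$ Moreover, there is $c_o\in\mathbb R^n$ such that $c_o^\top H_o(s)=N_n(s)/N_d(s)$ with stable polynomials $N_n,N_d$ and $\deg N_d=\deg N_n+1$, and for every such $c_o$ $$\|u-u_{ref}\|_{\mathcal L_\infty}\le\gamma_4=\Big\|C(s)\frac{1}{c_o^\top H_o(s)}c_o^\top\Big\|_{\mathcal L_1}\sqrt{\frac{\theta_m}{\lambda_{\min}(P)\,\Gamma_c}}+\Big(\sum_{i=1}^n|K_i|+\|C(s)\|_{\mathcal L_1}\,\theta_{\max}\Big)\gamma_3 .$$ -/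

import Mathlib

open scoped Matrix Polynomial ENNReal

noncomputable section

namespace L1Adaptive

/-! ### Scalar transfer functions -/

/-- A nonzero real polynomial all of whose complex roots lie in the open left half-plane. -/
def StablePoly (p : ℝ[X]) : Prop :=
  p ≠ 0 ∧ ∀ z : ℂ, Polynomial.aeval z p = 0 → z.re < 0

/-- A rational transfer function is stable if its (reduced) denominator is a stable polynomial. -/
def Stable (G : RatFunc ℝ) : Prop := StablePoly G.denom

/-- Strictly proper: the degree of the numerator is smaller than that of the denominator. -/
def StrictlyProper (G : RatFunc ℝ) : Prop := G.num.degree < G.denom.degree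

/-- The expansion `G(s) = g₀ + g₁ s⁻¹ + g₂ s⁻² + ⋯` at infinity of a proper rational function, as
a power series in the variable `s⁻¹`: if `G = p / q` with `N = deg q`, it is
`(s⁻ᴺ p(s)) / (s⁻ᴺ q(s))`. -/
def expansion (G : RatFunc ℝ) : PowerSeries ℝ :=
  ((G.num.reflect G.denom.natDegree : ℝ[X]) : PowerSeries ℝ) *
    ((G.denom.reflect G.denom.natDegree : ℝ[X]) : PowerSeries ℝ)⁻¹

/-- The direct feedthrough `g₀ = G(∞)` of a proper transfer function. -/
def feedthrough (G : RatFunc ℝ) : ℝ := PowerSeries.coeff 0 (expansion G)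

/-- The regular part of the impulse response of a proper transfer function `G`, that is, the inverse
Laplace transform of `G - G(∞)`: since `s⁻ᵏ⁻¹` is the Laplace transform of `tᵏ / k!`, it is
`h(t) = ∑ₖ gₖ₊₁ tᵏ / k!`. The full impulse response is `g₀ δ + h`. -/
def impulse (G : RatFunc ℝ) (t : ℝ) : ℝ :=
  ∑' k : ℕ, PowerSeries.coeff (k + 1) (expansion G) * t ^ k / (k.factorial : ℝ)

/-- The response at time `t`, with zero initial conditions, of the proper transfer function `G` to
the input signal `v`: the signal with Laplace transform `G(s) v(s)`. -/
def response (G : RatFunc ℝ) (v : ℝ → ℝ) (t : ℝ) : ℝ :=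
  feedthrough G * v t + ∫ τ in (0 : ℝ)..t, impulse G (t - τ) * v τ

/-- The `L₁` gain of a stable proper single-input single-output system: the total mass of its
impulse response `g₀ δ + h`. -/
def l1Gain (G : RatFunc ℝ) : ℝ :=
  |feedthrough G| + ∫ t in Set.Ioi (0 : ℝ), |impulse G t|

/-- The `L₁` gain of a stable proper system with `m` inputs and `p` outputs. -/
def l1GainMat {p m : ℕ} (H : Matrix (Fin p) (Fin m) (RatFunc ℝ)) : ℝ :=
  ⨆ i, ∑ j, l1Gain (H i j)

/-! ### Signals -/

/-- The `L∞` norm of a signal on `[0, ∞)`. For `E = Fin n → ℝ`, whose norm is the maximum of the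
absolute values of the components, it is `maxᵢ sup_{t ≥ 0} |ξᵢ(t)|`. -/
def linftyNorm {E : Type*} [NormedAddCommGroup E] (ξ : ℝ → E) : ℝ≥0∞ :=
  ⨆ t ∈ Set.Ici (0 : ℝ), ‖ξ t‖ₑ

/-! ### Linear systems -/

/-- All complex eigenvalues of `A` have negative real part. -/
def IsHurwitz {n : ℕ} (A : Matrix (Fin n) (Fin n) ℝ) : Prop :=
  ∀ z ∈ spectrum ℂ (A.map (algebraMap ℝ ℂ)), z.re < 0

/-- Controllability of the pair `(A, b)`: the vectors `b, A b, …, Aⁿ⁻¹ b` span `ℝⁿ`. -/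
def IsControllable {n : ℕ} (A : Matrix (Fin n) (Fin n) ℝ) (b : Fin n → ℝ) : Prop :=
  Submodule.span ℝ (Set.range fun k : Fin n => (A ^ (k : ℕ)) *ᵥ b) = ⊤

/-- `A_m = A - b Kᵀ`. -/
def Am {n : ℕ} (A : Matrix (Fin n) (Fin n) ℝ) (b K : Fin n → ℝ) : Matrix (Fin n) (Fin n) ℝ :=
  A - Matrix.vecMulVec b K

/-- The vector of transfer functions `H_o(s) = (s I - A_m)⁻¹ b`. -/
def Ho {n : ℕ} (A : Matrix (Fin n) (Fin n) ℝ) (b K : Fin n → ℝ) : Fin n → RatFunc ℝ :=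
  (Matrix.scalar (Fin n) (RatFunc.X : RatFunc ℝ) - (Am A b K).map RatFunc.C)⁻¹ *ᵥ
    fun i => RatFunc.C (b i)

/-- The scalar transfer function `vᵀ H_o(s)`. -/
def vecHo {n : ℕ} (A : Matrix (Fin n) (Fin n) ℝ) (b K v : Fin n → ℝ) : RatFunc ℝ :=
  ∑ i, RatFunc.C (v i) * Ho A b K i

/-- The feedforward gain `k_g = 1 / (cᵀ H_o(0))`. -/
def kg {n : ℕ} (A : Matrix (Fin n) (Fin n) ℝ) (b c K : Fin n → ℝ) : ℝ :=
  1 / RatFunc.eval (RingHom.id ℝ) 0 (vecHo A b K c)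

/-- `v ∈ ℝⁿ` is such that `vᵀ H_o(s) = N_n(s) / N_d(s)`, where `N_n` and `N_d` are stable polynomials
and the order of `N_d` is one more than the order of `N_n`. -/
def IsMinPhaseOutput {n : ℕ} (A : Matrix (Fin n) (Fin n) ℝ) (b K v : Fin n → ℝ) : Prop :=
  ∃ Nn Nd : ℝ[X], StablePoly Nn ∧ StablePoly Nd ∧ Nd.natDegree = Nn.natDegree + 1 ∧
    vecHo A b K v = algebraMap ℝ[X] (RatFunc ℝ) Nn / algebraMap ℝ[X] (RatFunc ℝ) Nd

/-- The column of transfer functions `H_o(s) (C(s) - 1)`. -/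
def Gbar {n : ℕ} (A : Matrix (Fin n) (Fin n) ℝ) (b K : Fin n → ℝ) (C : RatFunc ℝ) :
    Matrix (Fin n) (Fin 1) (RatFunc ℝ) :=
  fun i _ => Ho A b K i * (C - 1)

/-- The column of transfer functions `H_o(s) (1 - C(s))`. -/
def HoOneSub {n : ℕ} (A : Matrix (Fin n) (Fin n) ℝ) (b K : Fin n → ℝ) (C : RatFunc ℝ) :
    Matrix (Fin n) (Fin 1) (RatFunc ℝ) :=
  fun i _ => Ho A b K i * (1 - C)

/-- The row of transfer functions `C(s) (1 / (vᵀ H_o(s))) vᵀ`. -/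
def filteredInverse {n : ℕ} (A : Matrix (Fin n) (Fin n) ℝ) (b K : Fin n → ℝ) (C : RatFunc ℝ)
    (v : Fin n → ℝ) : Matrix (Fin 1) (Fin n) (RatFunc ℝ) :=
  fun _ j => C * (1 / vecHo A b K v) * RatFunc.C (v j)

/-! ### The projection operator of the adaptive law -/

/-- A point of `S` nearest to `y` in the Euclidean norm (unique if `S` is nonempty, closed and
convex). -/
def nearest {n : ℕ} (S : Set (EuclideanSpace ℝ (Fin n))) (y : EuclideanSpace ℝ (Fin n)) :
    EuclideanSpace ℝ (Fin n) :=
  Classical.epsilon fun z => z ∈ S ∧ ∀ w ∈ S, ‖y - z‖ ≤ ‖y - w‖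

/-- The tangent cone at `p` of a convex set `Θ`: the closure of the cone generated by `Θ - p`. -/
def tangentCone {n : ℕ} (Θ : Set (EuclideanSpace ℝ (Fin n))) (p : EuclideanSpace ℝ (Fin n)) :
    Set (EuclideanSpace ℝ (Fin n)) :=
  closure {v | ∃ a : ℝ, 0 ≤ a ∧ ∃ z ∈ Θ, v = a • (z - p)}

/-- The projection operator `Proj(p, y)` relative to the compact convex set `Θ`: the direction of
motion `y` is replaced by the nearest direction that is tangent to `Θ` at `p`. It is `y` itself if
`p` is an interior point, and at a smooth boundary point it removes from `y` the outward normal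
component, if there is one. -/
def proj {n : ℕ} (Θ : Set (EuclideanSpace ℝ (Fin n))) (p y : EuclideanSpace ℝ (Fin n)) :
    EuclideanSpace ℝ (Fin n) :=
  nearest (tangentCone Θ p) y

/-! ### Constants -/

/-- `θ_max`: the maximum over `Θ` of `∑ᵢ |θᵢ|`. -/
def thetaMax {n : ℕ} (Θ : Set (EuclideanSpace ℝ (Fin n))) : ℝ :=
  sSup ((fun p : EuclideanSpace ℝ (Fin n) => ∑ i, |p i|) '' Θ)

/-- The smallest eigenvalue of a symmetric real matrix. -/
def lamMin {n : ℕ} (M : Matrix (Fin n) (Fin n) ℝ) : ℝ := sInf (spectrum ℝ M)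

/-- The largest eigenvalue of a symmetric real matrix. -/
def lamMax {n : ℕ} (M : Matrix (Fin n) (Fin n) ℝ) : ℝ := sSup (spectrum ℝ M)

/-- `θ_m = max_Θ ∑ᵢ 4 θᵢ² + 2 (d_θ λ_max(P) / λ_min(Q)) max_Θ ‖θ‖`, with the Euclidean norm. -/
def thetaM {n : ℕ} (Θ : Set (EuclideanSpace ℝ (Fin n))) (P Q : Matrix (Fin n) (Fin n) ℝ)
    (dθ : ℝ) : ℝ :=
  sSup ((fun p : EuclideanSpace ℝ (Fin n) => ∑ i, 4 * p i ^ 2) '' Θ) +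
    2 * (dθ * lamMax P / lamMin Q) * sSup ((fun p : EuclideanSpace ℝ (Fin n) => ‖p‖) '' Θ)

/-- The bound for the state. -/
def gamma3 {n : ℕ} (A : Matrix (Fin n) (Fin n) ℝ) (b K : Fin n → ℝ) (C : RatFunc ℝ)
    (Θ : Set (EuclideanSpace ℝ (Fin n))) (P Q : Matrix (Fin n) (Fin n) ℝ) (Γc dθ : ℝ) : ℝ :=
  l1Gain C / (1 - l1GainMat (HoOneSub A b K C) * thetaMax Θ) *
    Real.sqrt (thetaM Θ P Q dθ / (lamMin P * Γc))

/-- The bound for the control; `∑ᵢ |Kᵢ|` is the `L₁` gain of the constant row `Kᵀ`. -/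
def gamma4 {n : ℕ} (A : Matrix (Fin n) (Fin n) ℝ) (b K : Fin n → ℝ) (C : RatFunc ℝ)
    (Θ : Set (EuclideanSpace ℝ (Fin n))) (P Q : Matrix (Fin n) (Fin n) ℝ) (Γc dθ : ℝ)
    (co : Fin n → ℝ) : ℝ :=
  l1GainMat (filteredInverse A b K C co) * Real.sqrt (thetaM Θ P Q dθ / (lamMin P * Γc)) +
    ((∑ i, |K i|) + l1Gain C * thetaMax Θ) * gamma3 A b K C Θ P Q Γc dθ

/-! ### The two closed loops -/

/-- The right-hand side `Γ_c Proj(θ̂, x x̃ᵀ P b)`, `x̃ = x̂ - x`, of the adaptive law. -/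
def adaptRate {n : ℕ} (Θ : Set (EuclideanSpace ℝ (Fin n))) (P : Matrix (Fin n) (Fin n) ℝ)
    (b : Fin n → ℝ) (Γc : ℝ) (θhat : EuclideanSpace ℝ (Fin n)) (x xhat : Fin n → ℝ) :
    EuclideanSpace ℝ (Fin n) :=
  Γc • proj Θ θhat (WithLp.toLp 2 (((xhat - x) ⬝ᵥ (P *ᵥ b)) • x))

/-- `x`, `u` are the state and the control of the plant
`x' = A x + b (u - θ(t)ᵀ x)`, `x(0) = x₀`, on `[0, ∞)`. -/
structure IsPlant {n : ℕ} (A : Matrix (Fin n) (Fin n) ℝ) (b : Fin n → ℝ) (x₀ : Fin n → ℝ)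
    (θ : ℝ → EuclideanSpace ℝ (Fin n)) (x : ℝ → Fin n → ℝ) (u : ℝ → ℝ) : Prop where
  init : x 0 = x₀
  ode : ∀ t, 0 ≤ t →
    HasDerivWithinAt x (A *ᵥ x t + (u t - (θ t).ofLp ⬝ᵥ x t) • b) (Set.Ici 0) t

/-- `x`, `u`, `x̂`, `θ̂` are the signals of the plant in closed loop with the adaptive controller:
state predictor, adaptive law and control law. The right-hand side of the adaptive law is
discontinuous at the boundary of `Θ`; its solutions are understood in the sense of Carathéodory. -/
structure IsAdaptiveLoop {n : ℕ} (A : Matrix (Fin n) (Fin n) ℝ) (b c K : Fin n → ℝ)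
    (C : RatFunc ℝ) (Θ : Set (EuclideanSpace ℝ (Fin n))) (P : Matrix (Fin n) (Fin n) ℝ) (Γc : ℝ)
    (r : ℝ → ℝ) (x₀ : Fin n → ℝ) (θhat₀ : EuclideanSpace ℝ (Fin n))
    (θ : ℝ → EuclideanSpace ℝ (Fin n)) (x : ℝ → Fin n → ℝ) (u : ℝ → ℝ)
    (xhat : ℝ → Fin n → ℝ) (θhat : ℝ → EuclideanSpace ℝ (Fin n)) : Prop where
  plant : IsPlant A b x₀ θ x u
  /-- `u = u₁ + u₂`, `u₁ = -Kᵀ x`, `u₂(s) = C(s) (r̄(s) + k_g r(s))`, `r̄ = θ̂ᵀ x`. -/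
  control : ∀ t, 0 ≤ t →
    u t = -(K ⬝ᵥ x t) + response C (fun τ => (θhat τ).ofLp ⬝ᵥ x τ + kg A b c K * r τ) t
  predictor_init : xhat 0 = x₀
  /-- `x̂' = A_m x̂ - b θ̂ᵀ x + b u₂`, where `u₂ = u + Kᵀ x`. -/
  predictor : ∀ t, 0 ≤ t →
    HasDerivWithinAt xhat
      (Am A b K *ᵥ xhat t - ((θhat t).ofLp ⬝ᵥ x t) • b + (u t + K ⬝ᵥ x t) • b) (Set.Ici 0) t
  adapt_integrable : ∀ t, 0 ≤ t → IntervalIntegrable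
    (fun τ => adaptRate Θ P b Γc (θhat τ) (x τ) (xhat τ)) MeasureTheory.volume 0 t
  adapt : ∀ t, 0 ≤ t →
    θhat t = θhat₀ + ∫ τ in (0 : ℝ)..t, adaptRate Θ P b Γc (θhat τ) (x τ) (xhat τ)

/-- `x_ref`, `u_ref` are the signals of the closed-loop reference system: the same plant, from the
same initial state, with the non-adaptive control
`u_ref(s) = C(s) (k_g r(s) + η(s)) - Kᵀ x_ref(s)`, `η = θᵀ x_ref`. -/
structure IsReferenceLoop {n : ℕ} (A : Matrix (Fin n) (Fin n) ℝ) (b c K : Fin n → ℝ)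
    (C : RatFunc ℝ) (r : ℝ → ℝ) (x₀ : Fin n → ℝ) (θ : ℝ → EuclideanSpace ℝ (Fin n))
    (xref : ℝ → Fin n → ℝ) (uref : ℝ → ℝ) : Prop where
  plant : IsPlant A b x₀ θ xref uref
  control : ∀ t, 0 ≤ t →
    uref t = response C (fun τ => kg A b c K * r τ + (θ τ).ofLp ⬝ᵥ xref τ) t - K ⬝ᵥ xref t

end L1Adaptive

end

/-!
Subtracting the plant from the predictor, `x̃ = x̂ - x` satisfies
`x̃' = A_m x̃ - b (θ̂ - θ)ᵀ x` with `x̃(0) = 0`. By the variational inequality of the projection,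
the Lyapunov function `V = Γ_c x̃ᵀ P x̃ + ‖θ̂ - θ‖² - ‖θ‖²` satisfies
`V' ≤ -Γ_c x̃ᵀ Q x̃ - 2 ⟪θ̂, θ'⟫`. Let `M = max_Θ ‖θ‖`. As
`Γ_c x̃ᵀ P x̃ - M² ≤ V ≤ Γ_c x̃ᵀ P x̃ + 3 M²`, `V` cannot increase above
`3 M² + 2 M d_θ λ_max(P) / λ_min(Q)`, so that `Γ_c x̃ᵀ P x̃ ≤ θ_m` for all time, and therefore
`‖x̃‖ ≤ √(θ_m / (λ_min(P) Γ_c))`.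

Let `e = x - x_ref`, `σ = θᵀ e` and `w = -(θ̂ - θ)ᵀ x`, so that `x̃ = H_o w`. Proper transfer
functions act on the continuous signals on `[0, T]` as commuting operators, namely power series in
the integration operator `s⁻¹`. Hence `e = H_o (C (σ - w) - σ) = H_o (C - 1) σ - C x̃`, and the gain
requirement absorbs the first term. If `vᵀ H_o` has stable zeros and relative degree one, then
`C (vᵀ H_o)⁻¹` is stable and proper, and `C w = C (vᵀ H_o)⁻¹ vᵀ x̃` bounds the difference of the
controls. By controllability every polynomial of degree less than `n`, for example `(s + 1)ⁿ⁻¹`, is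
the numerator of `vᵀ H_o` over `det (s I - A_m)` for some `v`.
-/

open scoped NNReal

noncomputable section

namespace L1Adaptive

/-! ### Proper rational functions and their expansions at infinity -/

section Proper

/-- The algebra of proper rational functions: those without a pole at infinity. -/
def properTransfer : Subalgebra ℝ (RatFunc ℝ) where
  carrier := {G | G.intDegree ≤ 0}
  mul_mem' {G H} hG hH := by
    by_cases hG0 : G = 0
    · simp [hG0]
    by_cases hH0 : H = 0
    · simp [hH0]
    exact (RatFunc.intDegree_mul hG0 hH0).trans_le (add_nonpos hG hH)
  add_mem' {G H} hG hH := by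
    by_cases hH0 : H = 0
    · simpa [hH0] using hG
    by_cases hGH : G + H = 0
    · simp [hGH]
    exact (RatFunc.intDegree_add_le hH0 hGH).trans (max_le hG hH)
  algebraMap_mem' a := (RatFunc.intDegree_C a).le

variable {G H : RatFunc ℝ}

theorem mem_properTransfer : G ∈ properTransfer ↔ G.intDegree ≤ 0 := Iff.rfl

theorem C_mem_properTransfer (a : ℝ) : RatFunc.C a ∈ properTransfer :=
  properTransfer.algebraMap_mem a

theorem inv_X_mem_properTransfer : (RatFunc.X : RatFunc ℝ)⁻¹ ∈ properTransfer := by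
  simp [mem_properTransfer]

theorem div_mem_properTransfer {p q : ℝ[X]} (hq : q ≠ 0) (h : p.natDegree ≤ q.natDegree) :
    algebraMap ℝ[X] (RatFunc ℝ) p / algebraMap ℝ[X] (RatFunc ℝ) q ∈ properTransfer := by
  by_cases hp : p = 0
  · simp [hp]
  rw [mem_properTransfer, RatFunc.intDegree_div (RatFunc.algebraMap_ne_zero hp)
    (RatFunc.algebraMap_ne_zero hq), RatFunc.intDegree_polynomial, RatFunc.intDegree_polynomial]
  lia

theorem natDegree_num_le_of_mem_properTransfer (h : G ∈ properTransfer) :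
    G.num.natDegree ≤ G.denom.natDegree := by
  rw [mem_properTransfer, RatFunc.intDegree] at h
  lia

theorem StrictlyProper.intDegree_neg (h : StrictlyProper G) (h0 : G ≠ 0) : G.intDegree < 0 := by
  have := Polynomial.natDegree_lt_natDegree (RatFunc.num_ne_zero h0) h
  rw [RatFunc.intDegree]
  lia

theorem StrictlyProper.mem_properTransfer (h : StrictlyProper G) : G ∈ properTransfer := by
  by_cases h0 : G = 0
  · exact h0 ▸ properTransfer.zero_mem
  · exact (h.intDegree_neg h0).le

theorem coe_reflect_ne_zero {q : ℝ[X]} (hq : q ≠ 0) (N : ℕ) :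
    ((q.reflect N : ℝ[X]) : PowerSeries ℝ) ≠ 0 := by
  simpa using hq

theorem expansion_mul_reflect_denom (G : RatFunc ℝ) :
    expansion G * ((G.denom.reflect G.denom.natDegree : ℝ[X]) : PowerSeries ℝ) =
      ((G.num.reflect G.denom.natDegree : ℝ[X]) : PowerSeries ℝ) := by
  have hunit : (G.denom.reflect G.denom.natDegree).coeff 0 = 1 := by
    rw [Polynomial.coeff_reflect, Polynomial.revAt_le (Nat.zero_le _), Nat.sub_zero]
    exact RatFunc.monic_denom G
  rw [expansion, mul_assoc, PowerSeries.inv_mul_cancel, mul_one]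
  rw [← PowerSeries.coeff_zero_eq_constantCoeff_apply, Polynomial.coeff_coe, hunit]
  exact one_ne_zero

theorem expansion_mul_reflect (hG : G ∈ properTransfer) {p q : ℝ[X]} (hq : q ≠ 0)
    (h : G = algebraMap ℝ[X] (RatFunc ℝ) p / algebraMap ℝ[X] (RatFunc ℝ) q) {N : ℕ}
    (hpN : p.natDegree ≤ N) (hqN : q.natDegree ≤ N) :
    expansion G * ((q.reflect N : ℝ[X]) : PowerSeries ℝ) =
      ((p.reflect N : ℝ[X]) : PowerSeries ℝ) := by
  have hcross : p * G.denom = q * G.num := by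
    have hdiv := (RatFunc.num_div_denom G).trans h
    rw [div_eq_div_iff (RatFunc.algebraMap_ne_zero (RatFunc.denom_ne_zero G))
      (RatFunc.algebraMap_ne_zero hq), ← map_mul, ← map_mul] at hdiv
    rw [← RatFunc.algebraMap_injective ℝ hdiv, mul_comm]
  have hreflect := congrArg (fun f => ((f.reflect (N + G.denom.natDegree) : ℝ[X]) : PowerSeries ℝ))
    hcross
  simp only [Polynomial.reflect_mul _ _ hpN le_rfl, Polynomial.reflect_mul _ _ hqN
    (natDegree_num_le_of_mem_properTransfer hG), Polynomial.coe_mul,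
    ← expansion_mul_reflect_denom G] at hreflect
  apply mul_right_cancel₀ (coe_reflect_ne_zero (RatFunc.denom_ne_zero G) G.denom.natDegree)
  rw [hreflect]
  ring

theorem expansion_eq_of_mul_reflect (hG : G ∈ properTransfer) {p q : ℝ[X]} (hq : q ≠ 0)
    (h : G = algebraMap ℝ[X] (RatFunc ℝ) p / algebraMap ℝ[X] (RatFunc ℝ) q) {N : ℕ}
    (hpN : p.natDegree ≤ N) (hqN : q.natDegree ≤ N) {f : PowerSeries ℝ}
    (hf : f * ((q.reflect N : ℝ[X]) : PowerSeries ℝ) = ((p.reflect N : ℝ[X]) : PowerSeries ℝ)) :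
    expansion G = f :=
  mul_right_cancel₀ (coe_reflect_ne_zero hq N)
    ((expansion_mul_reflect hG hq h hpN hqN).trans hf.symm)

theorem expansion_mul (hG : G ∈ properTransfer) (hH : H ∈ properTransfer) :
    expansion (G * H) = expansion G * expansion H := by
  have hG' := natDegree_num_le_of_mem_properTransfer hG
  have hH' := natDegree_num_le_of_mem_properTransfer hH
  refine expansion_eq_of_mul_reflect (mul_mem hG hH) (p := G.num * H.num)
    (q := G.denom * H.denom) (N := G.denom.natDegree + H.denom.natDegree)
    (mul_ne_zero (RatFunc.denom_ne_zero G) (RatFunc.denom_ne_zero H)) ?_ ?_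
    Polynomial.natDegree_mul_le ?_
  · rw [map_mul, map_mul, mul_div_mul_comm, RatFunc.num_div_denom, RatFunc.num_div_denom]
  · exact Polynomial.natDegree_mul_le.trans (add_le_add hG' hH')
  · rw [Polynomial.reflect_mul _ _ le_rfl le_rfl, Polynomial.reflect_mul _ _ hG' hH',
      Polynomial.coe_mul, Polynomial.coe_mul, ← expansion_mul_reflect_denom G,
      ← expansion_mul_reflect_denom H]
    ring

theorem expansion_add (hG : G ∈ properTransfer) (hH : H ∈ properTransfer) :
    expansion (G + H) = expansion G + expansion H := by
  have hG' := natDegree_num_le_of_mem_properTransfer hG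
  have hH' := natDegree_num_le_of_mem_properTransfer hH
  refine expansion_eq_of_mul_reflect (add_mem hG hH)
    (p := G.num * H.denom + G.denom * H.num) (q := G.denom * H.denom)
    (N := G.denom.natDegree + H.denom.natDegree)
    (mul_ne_zero (RatFunc.denom_ne_zero G) (RatFunc.denom_ne_zero H)) ?_ ?_
    Polynomial.natDegree_mul_le ?_
  · rw [map_add, map_mul, map_mul, map_mul,
      ← div_add_div _ _ (RatFunc.algebraMap_ne_zero (RatFunc.denom_ne_zero G))
        (RatFunc.algebraMap_ne_zero (RatFunc.denom_ne_zero H)),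
      RatFunc.num_div_denom, RatFunc.num_div_denom]
  · exact Polynomial.natDegree_add_le_of_degree_le
      (Polynomial.natDegree_mul_le.trans (add_le_add hG' le_rfl))
      (Polynomial.natDegree_mul_le.trans (add_le_add le_rfl hH'))
  · rw [Polynomial.reflect_add, Polynomial.reflect_mul _ _ le_rfl le_rfl,
      Polynomial.reflect_mul _ _ hG' le_rfl, Polynomial.reflect_mul _ _ le_rfl hH',
      Polynomial.coe_mul, Polynomial.coe_add, Polynomial.coe_mul, Polynomial.coe_mul,
      ← expansion_mul_reflect_denom G, ← expansion_mul_reflect_denom H]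
    ring

theorem expansion_C (a : ℝ) : expansion (RatFunc.C a) = PowerSeries.C a :=
  expansion_eq_of_mul_reflect (C_mem_properTransfer a) (p := Polynomial.C a) (q := 1) (N := 0)
    one_ne_zero (by simp) (by simp) (by simp) (by simp [Polynomial.reflect_one])

theorem expansion_inv_X : expansion (RatFunc.X : RatFunc ℝ)⁻¹ = PowerSeries.X :=
  expansion_eq_of_mul_reflect inv_X_mem_properTransfer (p := 1) (q := Polynomial.X) (N := 1)
    Polynomial.X_ne_zero (by simp) (by simp) (by simp)
    (by simp [Polynomial.reflect_one, Polynomial.reflect_one_X])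

end Proper

/-! ### Linear recurrences -/

section Recurrence

/-- The left shift of sequences in an `R`-module. A sequence satisfies the linear recurrence with
characteristic polynomial `q` if it is annihilated by `q` evaluated at the shift. -/
def leftShift (R M : Type*) [CommSemiring R] [AddCommMonoid M] [Module R M] :
    Module.End R (ℕ → M) :=
  LinearMap.funLeft R M Nat.succ

variable {R M : Type*} [CommSemiring R] [AddCommMonoid M] [Module R M]

@[simp]
theorem leftShift_apply (a : ℕ → M) (k : ℕ) : leftShift R M a k = a (k + 1) := rfl

theorem leftShift_pow_apply (j : ℕ) (a : ℕ → M) (k : ℕ) :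
    (leftShift R M ^ j) a k = a (k + j) := by
  induction j generalizing k with
  | zero => rfl
  | succ j ih =>
    rw [pow_succ', Module.End.mul_apply, leftShift_apply, ih, add_right_comm, add_assoc]

theorem aeval_leftShift_apply (q : R[X]) (a : ℕ → M) (k : ℕ) :
    Polynomial.aeval (leftShift R M) q a k =
      ∑ j ∈ Finset.range (q.natDegree + 1), q.coeff j • a (k + j) := by
  simp [Polynomial.aeval_eq_sum_range, LinearMap.sum_apply, leftShift_pow_apply]

theorem coeff_mul_reflect (f : PowerSeries R) (q : R[X]) (k : ℕ) :
    PowerSeries.coeff (q.natDegree + k)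
        (f * ((q.reflect q.natDegree : R[X]) : PowerSeries R)) =
      Polynomial.aeval (leftShift R R) q (fun k => PowerSeries.coeff k f) k := by
  rw [aeval_leftShift_apply, mul_comm, PowerSeries.coeff_mul,
    Finset.Nat.sum_antidiagonal_eq_sum_range_succ_mk, Nat.succ_eq_add_one, add_right_comm,
    Finset.sum_range_add]
  have htail : ∀ i ∈ Finset.range k, PowerSeries.coeff (q.natDegree + 1 + i)
      ((q.reflect q.natDegree : R[X]) : PowerSeries R) *
        PowerSeries.coeff (q.natDegree + k - (q.natDegree + 1 + i)) f = 0 := fun i _ => by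
    rw [Polynomial.coeff_coe, Polynomial.coeff_reflect, Polynomial.revAt_eq_self_of_lt (by lia),
      Polynomial.coeff_eq_zero_of_natDegree_lt (by lia), zero_mul]
  rw [Finset.sum_eq_zero htail, add_zero, ← Finset.sum_range_reflect]
  refine Finset.sum_congr rfl fun j hj => ?_
  have hj' : j ≤ q.natDegree := Finset.mem_range_succ_iff.mp hj
  rw [Polynomial.coeff_coe, Polynomial.coeff_reflect, Nat.add_sub_cancel, smul_eq_mul,
    Polynomial.revAt_le (Nat.sub_le _ _), Nat.sub_sub_self hj',
    show q.natDegree + k - (q.natDegree - j) = k + j by lia]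

theorem aeval_leftShift_denom_expansion {G : RatFunc ℝ} (hG : G ∈ properTransfer) :
    Polynomial.aeval (leftShift ℝ ℝ) G.denom (fun k => PowerSeries.coeff (k + 1) (expansion G)) =
      0 := by
  funext k
  have h := coeff_mul_reflect (expansion G) G.denom (k + 1)
  rw [expansion_mul_reflect_denom, Polynomial.coeff_coe, Polynomial.coeff_reflect,
    Polynomial.revAt_eq_self_of_lt (by lia), Polynomial.coeff_eq_zero_of_natDegree_lt
      ((natDegree_num_le_of_mem_properTransfer hG).trans_lt (by lia))] at h
  rw [aeval_leftShift_apply] at h ⊢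
  rw [Pi.zero_apply, h]
  exact Finset.sum_congr rfl fun j _ => by rw [add_right_comm]

end Recurrence

/-! ### Sequences of geometric growth and their exponential generating functions -/

section Growth

variable {E F : Type*} [NormedAddCommGroup E] [NormedAddCommGroup F]

/-- A sequence grows at most geometrically; this makes its exponential generating function
entire. -/
def GeometricGrowth (a : ℕ → E) : Prop :=
  ∃ M ρ : ℝ, 0 ≤ M ∧ 0 ≤ ρ ∧ ∀ k, ‖a k‖ ≤ M * ρ ^ k

theorem GeometricGrowth.shift {a : ℕ → E} (ha : GeometricGrowth a) :
    GeometricGrowth fun k => a (k + 1) := by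
  obtain ⟨M, ρ, hM, hρ, h⟩ := ha
  exact ⟨M * ρ, ρ, by positivity, hρ, fun k => (h (k + 1)).trans_eq (by ring)⟩

theorem GeometricGrowth.of_shift {a : ℕ → E} (ha : GeometricGrowth fun k => a (k + 1)) :
    GeometricGrowth a := by
  obtain ⟨M, ρ, hM, hρ, h⟩ := ha
  refine ⟨‖a 0‖ + M, ρ + 1, by positivity, by positivity, fun k => ?_⟩
  cases k with
  | zero => simpa using hM
  | succ k =>
    calc ‖a (k + 1)‖ ≤ M * ρ ^ k := h k
      _ ≤ (‖a 0‖ + M) * (ρ + 1) ^ (k + 1) := by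
          gcongr
          · exact le_add_of_nonneg_left (norm_nonneg _)
          · calc ρ ^ k ≤ (ρ + 1) ^ k := by gcongr; linarith
              _ ≤ (ρ + 1) ^ (k + 1) := pow_le_pow_right₀ (by linarith) k.le_succ

theorem GeometricGrowth.of_aeval_leftShift_eq_zero {𝕜 : Type*} [NormedField 𝕜] [NormedSpace 𝕜 E]
    {q : 𝕜[X]} (hq : q.Monic) {a : ℕ → E} (h : Polynomial.aeval (leftShift 𝕜 E) q a = 0) :
    GeometricGrowth a := by
  set N := q.natDegree
  set S := ∑ j ∈ Finset.range N, ‖q.coeff j‖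
  set B := ∑ i ∈ Finset.range (N + 1), ‖a i‖
  have hS : 0 ≤ S := Finset.sum_nonneg fun _ _ => norm_nonneg _
  have hB : 0 ≤ B := Finset.sum_nonneg fun _ _ => norm_nonneg _
  have hrec : ∀ k, a (k + N) = -∑ j ∈ Finset.range N, q.coeff j • a (k + j) := fun k => by
    have hk := (aeval_leftShift_apply q a k).symm.trans (congrFun h k)
    rw [Finset.sum_range_succ, hq.coeff_natDegree, one_smul] at hk
    exact eq_neg_of_add_eq_zero_right hk
  refine ⟨B, 1 + S, hB, by positivity, fun m => ?_⟩
  induction m using Nat.strong_induction_on with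
  | _ m ih =>
  obtain hm | hm := lt_or_ge m (N + 1)
  · calc ‖a m‖ ≤ B := Finset.single_le_sum (f := fun i => ‖a i‖) (fun _ _ => norm_nonneg _)
          (Finset.mem_range.mpr hm)
      _ ≤ B * (1 + S) ^ m := le_mul_of_one_le_right hB (one_le_pow₀ (by linarith))
  obtain ⟨k, rfl⟩ : ∃ k, m = k + 1 + N := ⟨m - (N + 1), by lia⟩
  have hterm : ∀ j ∈ Finset.range N,
      ‖q.coeff j • a (k + 1 + j)‖ ≤ ‖q.coeff j‖ * (B * (1 + S) ^ (k + N)) := fun j hj => by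
    have hj' := Finset.mem_range.mp hj
    rw [norm_smul]
    gcongr
    refine (ih (k + 1 + j) (by lia)).trans ?_
    exact mul_le_mul_of_nonneg_left (pow_le_pow_right₀ (by linarith) (by lia)) hB
  calc ‖a (k + 1 + N)‖ ≤ ∑ j ∈ Finset.range N, ‖q.coeff j‖ * (B * (1 + S) ^ (k + N)) := by
        rw [hrec, norm_neg]
        exact norm_sum_le_of_le _ hterm
    _ = S * (B * (1 + S) ^ (k + N)) := (Finset.sum_mul _ _ _).symm
    _ ≤ (1 + S) * (B * (1 + S) ^ (k + N)) := by gcongr; linarith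
    _ = B * (1 + S) ^ (k + 1 + N) := by ring

variable [NormedSpace ℝ E] [NormedSpace ℝ F]

theorem GeometricGrowth.map {a : ℕ → E} (ha : GeometricGrowth a) (L : E →L[ℝ] F) :
    GeometricGrowth fun k => L (a k) := by
  obtain ⟨M, ρ, hM, hρ, h⟩ := ha
  refine ⟨‖L‖ * M, ρ, by positivity, hρ, fun k => ?_⟩
  rw [mul_assoc]
  exact L.le_opNorm_of_le (h k)

theorem geometricGrowth_expansion {G : RatFunc ℝ} (hG : G ∈ properTransfer) :
    GeometricGrowth fun k => PowerSeries.coeff k (expansion G) :=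
  (GeometricGrowth.of_aeval_leftShift_eq_zero (RatFunc.monic_denom G)
    (aeval_leftShift_denom_expansion hG)).of_shift

/-- The exponential generating function `∑ₖ (tᵏ / k!) aₖ`. -/
def expSum (a : ℕ → E) (t : ℝ) : E := ∑' k : ℕ, (t ^ k / (k.factorial : ℝ)) • a k

theorem norm_expSum_term_le {a : ℕ → E} {M ρ : ℝ} (h : ∀ k, ‖a k‖ ≤ M * ρ ^ k) {t R : ℝ}
    (ht : |t| ≤ R) (k : ℕ) :
    ‖(t ^ k / (k.factorial : ℝ)) • a k‖ ≤ M * ((ρ * R) ^ k / k.factorial) := by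
  rw [norm_smul, norm_div, norm_pow, Real.norm_eq_abs, RCLike.norm_natCast]
  calc |t| ^ k / (k.factorial : ℝ) * ‖a k‖ ≤ R ^ k / (k.factorial : ℝ) * (M * ρ ^ k) := by
        have := h k
        gcongr
        exact div_nonneg (pow_nonneg ((abs_nonneg t).trans ht) k) (by positivity)
    _ = M * ((ρ * R) ^ k / k.factorial) := by ring

theorem hasDerivAt_expSum_term (v : E) (k : ℕ) (s : ℝ) :
    HasDerivAt (fun s : ℝ => (s ^ (k + 1) / ((k + 1).factorial : ℝ)) • v)
      ((s ^ k / (k.factorial : ℝ)) • v) s := by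
  have h := ((hasDerivAt_pow (k + 1) s).div_const ((k + 1).factorial : ℝ)).smul_const v
  refine h.congr_deriv ?_
  congr 1
  rw [Nat.factorial_succ, Nat.add_sub_cancel]
  push_cast
  field_simp

theorem expSum_zero_right (a : ℕ → E) : expSum a 0 = a 0 := by
  rw [expSum, tsum_eq_single 0 fun k hk => by simp [hk]]
  simp

variable [CompleteSpace E]

theorem GeometricGrowth.summable_expSum {a : ℕ → E} (ha : GeometricGrowth a) (t : ℝ) :
    Summable fun k : ℕ => (t ^ k / (k.factorial : ℝ)) • a k := by
  obtain ⟨M, ρ, -, -, h⟩ := ha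
  exact Summable.of_norm_bounded ((Real.summable_pow_div_factorial (ρ * |t|)).mul_left M)
    (norm_expSum_term_le h le_rfl)

theorem expSum_sub {a b : ℕ → E} (ha : GeometricGrowth a) (hb : GeometricGrowth b) (t : ℝ) :
    expSum (fun k => a k - b k) t = expSum a t - expSum b t := by
  simp only [expSum, smul_sub]
  exact (ha.summable_expSum t).tsum_sub (hb.summable_expSum t)

theorem expSum_map {a : ℕ → E} (ha : GeometricGrowth a) (L : E →L[ℝ] F) (t : ℝ) :
    expSum (fun k => L (a k)) t = L (expSum a t) := by
  rw [expSum, expSum, L.map_tsum (ha.summable_expSum t)]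
  exact tsum_congr fun k => (L.map_smul _ _).symm

theorem GeometricGrowth.hasDerivAt_expSum {a : ℕ → E} (ha : GeometricGrowth a) (t : ℝ) :
    HasDerivAt (expSum a) (expSum (fun k => a (k + 1)) t) t := by
  obtain ⟨M, ρ, -, -, h⟩ := ha.shift
  have ht : t ∈ Metric.ball (0 : ℝ) (|t| + 1) := by simp
  have htail : HasDerivAt
      (fun s : ℝ => ∑' k : ℕ, (s ^ (k + 1) / ((k + 1).factorial : ℝ)) • a (k + 1))
      (expSum (fun k => a (k + 1)) t) t :=
    hasDerivAt_tsum_of_isPreconnected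
      ((Real.summable_pow_div_factorial (ρ * (|t| + 1))).mul_left M) Metric.isOpen_ball
      (convex_ball (0 : ℝ) (|t| + 1)).isPreconnected
      (fun k s _ => hasDerivAt_expSum_term (a (k + 1)) k s)
      (fun k s hs => norm_expSum_term_le h (mem_ball_zero_iff.mp hs).le k) ht
      ((summable_nat_add_iff 1).mpr (ha.summable_expSum t)) ht
  have hsplit : expSum a = fun s : ℝ =>
      a 0 + ∑' k : ℕ, (s ^ (k + 1) / ((k + 1).factorial : ℝ)) • a (k + 1) := funext fun s => by
    rw [expSum, (ha.summable_expSum s).tsum_eq_zero_add]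
    simp
  rw [hsplit]
  exact htail.const_add _

theorem GeometricGrowth.continuous_expSum {a : ℕ → E} (ha : GeometricGrowth a) :
    Continuous (expSum a) :=
  continuous_iff_continuousAt.mpr fun t => (ha.hasDerivAt_expSum t).continuousAt

theorem impulse_eq_expSum (G : RatFunc ℝ) :
    impulse G = expSum fun k => PowerSeries.coeff (k + 1) (expansion G) :=
  funext fun t => tsum_congr fun k => by rw [smul_eq_mul]; ring

theorem continuous_impulse {G : RatFunc ℝ} (hG : G ∈ properTransfer) : Continuous (impulse G) :=
  impulse_eq_expSum G ▸ (geometricGrowth_expansion hG).shift.continuous_expSum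

end Growth

/-! ### Transfer functions as operators on signals -/

section Calculus

variable {𝔸 : Type*} [NormedRing 𝔸] [NormedAlgebra ℝ 𝔸]

/-- The value of a power series at an element of a Banach algebra. -/
def seriesEval (a : 𝔸) (f : PowerSeries ℝ) : 𝔸 := ∑' k : ℕ, PowerSeries.coeff k f • a ^ k

variable {a : 𝔸} {R : ℝ} {f g : PowerSeries ℝ}

theorem seriesEval_C (a : 𝔸) (c : ℝ) : seriesEval a (PowerSeries.C c) = algebraMap ℝ 𝔸 c := by
  rw [seriesEval, tsum_eq_single 0 fun k hk => by simp [PowerSeries.coeff_C, hk]]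
  simp [Algebra.algebraMap_eq_smul_one]

theorem seriesEval_X (a : 𝔸) : seriesEval a PowerSeries.X = a := by
  rw [seriesEval, tsum_eq_single 1 fun k hk => by simp [PowerSeries.coeff_X, hk]]
  simp

theorem summable_norm_coeff_smul_pow (ha : ∀ k, ‖a ^ k‖ ≤ R ^ k / (k.factorial : ℝ))
    (hf : GeometricGrowth fun k => PowerSeries.coeff k f) :
    Summable fun k : ℕ => ‖PowerSeries.coeff k f • a ^ k‖ := by
  obtain ⟨M, ρ, hM, hρ, h⟩ := hf
  refine .of_nonneg_of_le (fun _ => norm_nonneg _) (fun k => ?_)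
    ((Real.summable_pow_div_factorial (ρ * R)).mul_left M)
  calc ‖PowerSeries.coeff k f • a ^ k‖ ≤ (M * ρ ^ k) * (R ^ k / k.factorial) := by
        rw [norm_smul]
        exact mul_le_mul (h k) (ha k) (norm_nonneg _) (by positivity)
    _ = M * ((ρ * R) ^ k / k.factorial) := by ring

variable [CompleteSpace 𝔸]

theorem seriesEval_add (ha : ∀ k, ‖a ^ k‖ ≤ R ^ k / (k.factorial : ℝ))
    (hf : GeometricGrowth fun k => PowerSeries.coeff k f)
    (hg : GeometricGrowth fun k => PowerSeries.coeff k g) :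
    seriesEval a (f + g) = seriesEval a f + seriesEval a g := by
  simp only [seriesEval, map_add, add_smul]
  exact (summable_norm_coeff_smul_pow ha hf).of_norm.tsum_add
    (summable_norm_coeff_smul_pow ha hg).of_norm

theorem seriesEval_mul (ha : ∀ k, ‖a ^ k‖ ≤ R ^ k / (k.factorial : ℝ))
    (hf : GeometricGrowth fun k => PowerSeries.coeff k f)
    (hg : GeometricGrowth fun k => PowerSeries.coeff k g) :
    seriesEval a (f * g) = seriesEval a f * seriesEval a g := by
  rw [seriesEval, seriesEval, seriesEval, tsum_mul_tsum_eq_tsum_sum_antidiagonal_of_summable_norm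
    (summable_norm_coeff_smul_pow ha hf) (summable_norm_coeff_smul_pow ha hg)]
  refine tsum_congr fun k => ?_
  rw [PowerSeries.coeff_mul, Finset.sum_smul]
  refine Finset.sum_congr rfl fun p hp => ?_
  rw [smul_mul_smul_comm, ← pow_add, Finset.HasAntidiagonal.mem_antidiagonal.mp hp]

end Calculus

section Volterra

theorem integral_sub_pow_div_factorial (t : ℝ) (k : ℕ) :
    ∫ s in (0 : ℝ)..t, (t - s) ^ k / (k.factorial : ℝ) =
      t ^ (k + 1) / ((k + 1).factorial : ℝ) := by
  rw [intervalIntegral.integral_div, intervalIntegral.integral_comp_sub_left (fun s => s ^ k) t,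
    sub_self, sub_zero, integral_pow, zero_pow k.succ_ne_zero, sub_zero, div_div,
    Nat.factorial_succ]
  push_cast
  rfl

theorem hasDerivAt_neg_sub_pow_div_factorial (t : ℝ) (k : ℕ) (s : ℝ) :
    HasDerivAt (fun s : ℝ => -((t - s) ^ (k + 1) / ((k + 1).factorial : ℝ)))
      ((t - s) ^ k / (k.factorial : ℝ)) s := by
  have h := ((((hasDerivAt_id s).const_sub t).pow (k + 1)).div_const ((k + 1).factorial : ℝ)).neg
  refine h.congr_deriv ?_
  rw [Nat.factorial_succ, id, Nat.add_sub_cancel]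
  push_cast
  field_simp

theorem integral_sub_pow_mul_primitive {u : ℝ → ℝ} (hu : Continuous u) (k : ℕ) (t : ℝ) :
    ∫ s in (0 : ℝ)..t, (t - s) ^ k / (k.factorial : ℝ) * ∫ τ in (0 : ℝ)..s, u τ =
      ∫ s in (0 : ℝ)..t, (t - s) ^ (k + 1) / ((k + 1).factorial : ℝ) * u s := by
  have hU : ∀ s ∈ Set.uIcc (0 : ℝ) t,
      HasDerivAt (fun s : ℝ => ∫ τ in (0 : ℝ)..s, u τ) (u s) s :=
    fun s _ => intervalIntegral.integral_hasDerivAt_right (hu.intervalIntegrable _ _)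
      (hu.stronglyMeasurableAtFilter _ _) hu.continuousAt
  have hparts := intervalIntegral.integral_deriv_mul_eq_sub
    (fun s _ => hasDerivAt_neg_sub_pow_div_factorial t k s) hU
    (Continuous.intervalIntegrable (by fun_prop) _ _) (hu.intervalIntegrable _ _)
  simp only [sub_self, zero_pow k.succ_ne_zero, zero_div, neg_zero, zero_mul,
    intervalIntegral.integral_same, mul_zero, neg_mul, ← sub_eq_add_neg] at hparts
  refine sub_eq_zero.mp (Eq.trans ?_ hparts)
  refine (intervalIntegral.integral_sub ?_ ?_).symm
  · exact Continuous.intervalIntegrable (Continuous.mul (by fun_prop)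
      (intervalIntegral.continuous_primitive (fun a b => hu.intervalIntegrable a b) 0)) _ _
  · exact Continuous.intervalIntegrable (by fun_prop) _ _

variable (T : ℝ≥0)

/-- Signals on the finite horizon `[0, T]`, a Banach space for the sup norm. -/
abbrev Signal : Type := C(Set.Icc (0 : ℝ) T, ℝ)

variable {T}

theorem IccExtend_of_mem (v : Signal T) {t : ℝ} (ht : t ∈ Set.Icc (0 : ℝ) T) :
    v.IccExtend T.2 t = v ⟨t, ht⟩ :=
  Set.IccExtend_of_mem T.2 v ht

theorem IccExtend_eqOn {v : Signal T} {f : ℝ → ℝ} (h : ∀ t, v t = f t) :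
    Set.EqOn (v.IccExtend T.2) f (Set.Icc 0 T) :=
  fun s hs => (IccExtend_of_mem v hs).trans (h ⟨s, hs⟩)

variable (T)

/-- Integration from `0`, as an operator on signals. -/
def volterra : Signal T →L[ℝ] Signal T :=
  LinearMap.mkContinuous
    { toFun v := ⟨fun t => ∫ s in (0 : ℝ)..t, v.IccExtend T.2 s,
        (intervalIntegral.continuous_primitive
          (fun a b => (map_continuous (v.IccExtend T.2)).intervalIntegrable a b) 0).comp
          continuous_subtype_val⟩
      map_add' v w := ContinuousMap.ext fun t => intervalIntegral.integral_add
        ((map_continuous (v.IccExtend T.2)).intervalIntegrable _ _)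
        ((map_continuous (w.IccExtend T.2)).intervalIntegrable _ _)
      map_smul' c v := ContinuousMap.ext fun t =>
        intervalIntegral.integral_const_mul c (v.IccExtend T.2) }
    T fun v => by
      refine (ContinuousMap.norm_le _ (by positivity)).mpr fun t => ?_
      refine (intervalIntegral.norm_integral_le_of_norm_le_const (C := ‖v‖)
        fun s _ => v.norm_coe_le_norm _).trans ?_
      rw [sub_zero, abs_of_nonneg t.2.1, mul_comm]
      exact mul_le_mul_of_nonneg_right t.2.2 (norm_nonneg v)

variable {T}

theorem volterra_apply (v : Signal T) (t : Set.Icc (0 : ℝ) T) :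
    volterra T v t = ∫ s in (0 : ℝ)..t, v.IccExtend T.2 s := rfl

theorem volterra_pow_succ_apply (v : Signal T) (k : ℕ) (t : Set.Icc (0 : ℝ) T) :
    (volterra T ^ (k + 1)) v t =
      ∫ s in (0 : ℝ)..t, ((t : ℝ) - s) ^ k / (k.factorial : ℝ) * v.IccExtend T.2 s := by
  induction k generalizing v with
  | zero => simp [volterra_apply]
  | succ k ih =>
    rw [pow_succ, mul_apply_eq_comp, ih,
      ← integral_sub_pow_mul_primitive (map_continuous _)]
    refine intervalIntegral.integral_congr fun s hs => ?_
    rw [Set.uIcc_of_le t.2.1] at hs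
    exact congrArg _ (IccExtend_eqOn (f := fun s => ∫ τ in (0 : ℝ)..s, v.IccExtend T.2 τ)
      (volterra_apply v) ⟨hs.1, hs.2.trans t.2.2⟩)

theorem norm_volterra_pow_le (k : ℕ) : ‖volterra T ^ k‖ ≤ (T : ℝ) ^ k / (k.factorial : ℝ) := by
  refine ContinuousLinearMap.opNorm_le_bound _ (by positivity) fun v => ?_
  refine (ContinuousMap.norm_le _ (by positivity)).mpr fun t => ?_
  have ht : (t : ℝ) ^ k / (k.factorial : ℝ) * ‖v‖ ≤ (T : ℝ) ^ k / (k.factorial : ℝ) * ‖v‖ := by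
    have := t.2.1
    have := t.2.2
    gcongr
  refine le_trans ?_ ht
  cases k with
  | zero => simpa using v.norm_coe_le_norm t
  | succ k =>
    rw [volterra_pow_succ_apply, ← integral_sub_pow_div_factorial,
      ← intervalIntegral.integral_mul_const]
    refine intervalIntegral.norm_integral_le_of_norm_le t.2.1
      (.of_forall fun s hs => ?_) (Continuous.intervalIntegrable (by fun_prop) _ _)
    have hs' : 0 ≤ (t : ℝ) - s := sub_nonneg.mpr hs.2
    rw [norm_mul, Real.norm_of_nonneg (by positivity)]
    exact mul_le_mul_of_nonneg_left (v.norm_coe_le_norm _) (by positivity)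

variable (T)

/-- The action of proper transfer functions on signals: the input-output map, from zero initial
conditions, of the system. It is the functional calculus of the integration operator `1 / s`. -/
def transferOp : properTransfer →ₐ[ℝ] (Signal T →L[ℝ] Signal T) :=
  AlgHom.ofLinearMap
    { toFun G := seriesEval (volterra T) (expansion G)
      map_add' G H := by
        rw [Subalgebra.coe_add, expansion_add G.2 H.2, seriesEval_add norm_volterra_pow_le
          (geometricGrowth_expansion G.2) (geometricGrowth_expansion H.2)]
      map_smul' c G := by
        rw [Subalgebra.coe_smul, Algebra.smul_def, RatFunc.algebraMap_eq_C,
          expansion_mul (C_mem_properTransfer c) G.2, seriesEval_mul norm_volterra_pow_le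
            (geometricGrowth_expansion (C_mem_properTransfer c)) (geometricGrowth_expansion G.2),
          expansion_C, seriesEval_C, RingHom.id_apply, Algebra.smul_def] }
    (by
      change seriesEval (volterra T) (expansion 1) = 1
      rw [← map_one RatFunc.C, expansion_C, seriesEval_C, map_one])
    fun G H => (congrArg _ (expansion_mul G.2 H.2)).trans (seriesEval_mul norm_volterra_pow_le
      (geometricGrowth_expansion G.2) (geometricGrowth_expansion H.2))

variable {T}

theorem transferOp_eq_seriesEval (G : properTransfer) :
    transferOp T G = seriesEval (volterra T) (expansion G) := rfl

theorem transferOp_inv_X :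
    transferOp T ⟨(RatFunc.X : RatFunc ℝ)⁻¹, inv_X_mem_properTransfer⟩ = volterra T := by
  rw [transferOp_eq_seriesEval, expansion_inv_X, seriesEval_X]

theorem GeometricGrowth.hasSum_integral_expSum {a : ℕ → ℝ} (ha : GeometricGrowth a)
    {u : ℝ → ℝ} (hu : Continuous u) {t : ℝ} (ht : 0 ≤ t) :
    HasSum (fun k : ℕ => a k * ∫ s in (0 : ℝ)..t, (t - s) ^ k / (k.factorial : ℝ) * u s)
      (∫ s in (0 : ℝ)..t, expSum a (t - s) * u s) := by
  have hsum := ha.summable_expSum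
  obtain ⟨M, ρ, -, -, h⟩ := ha
  have hterm := intervalIntegral.hasSum_integral_of_dominated_convergence (a := 0) (b := t)
    (μ := MeasureTheory.volume)
    (F := fun (k : ℕ) s => ((t - s) ^ k / (k.factorial : ℝ)) • a k * u s)
    (f := fun s => expSum a (t - s) * u s)
    (fun k s => M * ((ρ * t) ^ k / k.factorial) * ‖u s‖)
    (fun k => Continuous.aestronglyMeasurable (by fun_prop))
    (fun k => .of_forall fun s hs => ?_)
    (.of_forall fun s _ => ((Real.summable_pow_div_factorial (ρ * t)).mul_left M).mul_right _)
    (by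
      simp only [tsum_mul_right]
      exact Continuous.intervalIntegrable (by fun_prop) _ _)
    (.of_forall fun s _ => (hsum (t - s)).hasSum.mul_right _)
  · refine hterm.congr_fun fun k => ?_
    rw [← intervalIntegral.integral_const_mul]
    refine intervalIntegral.integral_congr fun s _ => ?_
    simp only [smul_eq_mul]
    ring
  · rw [Set.uIoc_of_le ht] at hs
    rw [norm_mul]
    refine mul_le_mul_of_nonneg_right (norm_expSum_term_le h ?_ k) (norm_nonneg _)
    rw [abs_of_nonneg (sub_nonneg.mpr hs.2)]
    linarith [hs.1]

theorem transferOp_apply (G : properTransfer) {v : Signal T} {f : ℝ → ℝ} (h : ∀ t, v t = f t)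
    (t : Set.Icc (0 : ℝ) T) : transferOp T G v t = response G f t := by
  have hgrowth := geometricGrowth_expansion G.2
  have hseries : HasSum (fun k => PowerSeries.coeff k (expansion G) • volterra T ^ k)
      (transferOp T G) :=
    (summable_norm_coeff_smul_pow (a := volterra T) norm_volterra_pow_le hgrowth).of_norm.hasSum
  have hsum : HasSum (fun k => PowerSeries.coeff k (expansion G) * (volterra T ^ k) v t)
      (transferOp T G v t) :=
    (hseries.mapL (ContinuousLinearMap.apply ℝ (Signal T) v)).mapL (ContinuousMap.evalCLM ℝ t)
  have htail := hgrowth.shift.hasSum_integral_expSum (map_continuous (v.IccExtend T.2)) t.2.1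
  simp only [← volterra_pow_succ_apply] at htail
  rw [← hasSum_nat_add_iff' 1] at hsum
  have heq := hsum.unique htail
  rw [Finset.sum_range_one, pow_zero, one_apply_eq_self, sub_eq_iff_eq_add'] at heq
  rw [heq, h, ← impulse_eq_expSum, response, feedthrough]
  congr 1
  exact intervalIntegral.integral_congr fun s hs => by
    rw [Set.uIcc_of_le t.2.1] at hs
    simp only [IccExtend_eqOn h ⟨hs.1, hs.2.trans t.2.2⟩]

end Volterra

/-! ### Exponential decay and the `L₁` gain -/

section Decay

/-- Exponential decay on `[0, ∞)`. -/
def ExpDecay {E : Type*} [Norm E] (h : ℝ → E) : Prop :=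
  ∃ C ε : ℝ, 0 < ε ∧ ∀ t, 0 ≤ t → ‖h t‖ ≤ C * Real.exp (-ε * t)

theorem hasDerivAt_cexp_neg_mul (l : ℂ) (t : ℝ) :
    HasDerivAt (fun t : ℝ => Complex.exp (-l * t)) (-l * Complex.exp (-l * t)) t := by
  have h : HasDerivAt (fun t : ℝ => -l * (t : ℂ)) (-l) t := by
    simpa using (Complex.ofRealCLM.hasDerivAt (x := t)).const_mul (-l)
  simpa [mul_comm] using h.cexp

theorem norm_le_mul_exp_of_hasDerivAt {k k' : ℝ → ℂ} {C ν : ℝ} (hν : 0 < ν)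
    (hk : ∀ t, HasDerivAt k (k' t) t) (hC : ∀ t, 0 ≤ t → ‖k' t‖ ≤ C * Real.exp (ν * t))
    {t : ℝ} (ht : 0 ≤ t) : ‖k t‖ ≤ max ‖k 0‖ (C / ν) * Real.exp (ν * t) := by
  set D := max ‖k 0‖ (C / ν)
  have hB : ∀ s, HasDerivAt (fun s => D * Real.exp (ν * s)) (D * ν * Real.exp (ν * s)) s :=
    fun s => ((((hasDerivAt_id s).const_mul ν).exp).const_mul D).congr_deriv (by simp; ring)
  refine image_norm_le_of_norm_deriv_right_le_deriv_boundary (a := 0) (b := t)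
    (fun s _ => (hk s).continuousAt.continuousWithinAt) (fun s _ => (hk s).hasDerivWithinAt)
    (by simp [D]) hB (fun s hs => (hC s hs.1).trans ?_)
    (Set.right_mem_Icc.mpr ht)
  gcongr
  exact (div_le_iff₀ hν).mp (le_max_right _ _)

theorem ExpDecay.of_hasDerivAt {h g : ℝ → ℂ} {l : ℂ} (hl : l.re < 0) (hg : ExpDecay g)
    (hh : ∀ t, HasDerivAt h (l * h t + g t) t) : ExpDecay h := by
  obtain ⟨C, ε, hε, hC⟩ := hg
  have hC0 : 0 ≤ C := by simpa using (norm_nonneg _).trans (hC 0 le_rfl)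
  obtain ⟨δ, hδ, hδl⟩ := exists_between (lt_min hε (neg_pos.mpr hl))
  obtain ⟨hδε, hδl⟩ := lt_min_iff.mp hδl
  have hnorm : ∀ t : ℝ, ‖Complex.exp (-l * t)‖ = Real.exp (-l.re * t) := fun t => by
    simp [Complex.norm_exp]
  have hk : ∀ t : ℝ, HasDerivAt (fun t : ℝ => Complex.exp (-l * t) * h t)
      (Complex.exp (-l * t) * g t) t := fun t =>
    ((hasDerivAt_cexp_neg_mul l t).mul (hh t)).congr_deriv (by ring)
  have hk' : ∀ t : ℝ, 0 ≤ t →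
      ‖Complex.exp (-l * t) * g t‖ ≤ C * Real.exp ((-l.re - δ) * t) := fun t ht => by
    calc ‖Complex.exp (-l * t) * g t‖ ≤ Real.exp (-l.re * t) * (C * Real.exp (-δ * t)) := by
          rw [norm_mul, hnorm]
          gcongr
          exact (hC t ht).trans (by gcongr)
      _ = C * Real.exp ((-l.re - δ) * t) := by
          rw [mul_left_comm, ← Real.exp_add]
          ring_nf
  refine ⟨max ‖Complex.exp (-l * (0 : ℝ)) * h 0‖ (C / (-l.re - δ)), δ, hδ, fun t ht => ?_⟩
  have hbound := norm_le_mul_exp_of_hasDerivAt (by linarith : 0 < -l.re - δ) hk hk' ht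
  rw [norm_mul, hnorm] at hbound
  refine le_of_mul_le_mul_left (hbound.trans_eq ?_) (Real.exp_pos (-l.re * t))
  rw [mul_left_comm, ← Real.exp_add]
  ring_nf

-- Splitting off a root `l` of `q` turns the recurrence into the scalar equation `h' = l h + g`,
-- where `g` belongs to a recurrence of lower order.
theorem expDecay_expSum_of_roots {q : ℂ[X]} (hq : q.Monic) (hroots : ∀ z, q.IsRoot z → z.re < 0)
    {a : ℕ → ℂ} (h : Polynomial.aeval (leftShift ℂ ℂ) q a = 0) : ExpDecay (expSum a) := by
  induction hn : q.natDegree generalizing q a with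
  | zero =>
    rw [hq.natDegree_eq_zero.mp hn, map_one, Module.End.one_apply] at h
    exact ⟨0, 1, one_pos, fun t _ => by simp [h, expSum]⟩
  | succ n ih =>
    obtain ⟨l, hl⟩ := IsAlgClosed.exists_root q
      (Polynomial.degree_ne_of_natDegree_ne (n := 0) (by lia))
    have ha := GeometricGrowth.of_aeval_leftShift_eq_zero hq h
    obtain ⟨p, rfl⟩ := Polynomial.dvd_iff_isRoot.mpr hl
    have hp : p.Monic := (Polynomial.monic_X_sub_C l).of_mul_monic_left hq
    rw [(Polynomial.monic_X_sub_C l).natDegree_mul hp, Polynomial.natDegree_X_sub_C] at hn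
    have hreduced : ExpDecay (expSum fun k => a (k + 1) - l * a k) := by
      refine ih hp (fun z hz => hroots z (by simp [Polynomial.IsRoot.def.mp hz])) ?_ (by lia)
      rw [mul_comm, map_mul, Module.End.mul_apply] at h
      convert h using 2
      ext k
      simp
    refine .of_hasDerivAt (hroots l hl) hreduced fun t => (ha.hasDerivAt_expSum t).congr_deriv ?_
    have hla := expSum_map ha (ContinuousLinearMap.mul ℝ ℂ l) t
    have hsub := expSum_sub ha.shift (ha.map (ContinuousLinearMap.mul ℝ ℂ l)) t
    simp only [ContinuousLinearMap.mul_apply'] at hla hsub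
    rw [hsub, hla, add_sub_cancel]

theorem expDecay_expSum {q : ℝ[X]} (hq : q.Monic) (hs : StablePoly q) {a : ℕ → ℝ}
    (h : Polynomial.aeval (leftShift ℝ ℝ) q a = 0) : ExpDecay (expSum a) := by
  have hcomplex : ExpDecay (expSum fun k => Complex.ofRealCLM (a k)) := by
    refine expDecay_expSum_of_roots (hq.map (algebraMap ℝ ℂ)) (fun z hz => hs.2 z ?_) ?_
    · rwa [Polynomial.IsRoot.def, Polynomial.eval_map_algebraMap] at hz
    · ext k
      have hk := (aeval_leftShift_apply q a k).symm.trans (congrFun h k)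
      rw [aeval_leftShift_apply, Polynomial.natDegree_map]
      simpa using congrArg Complex.ofReal hk
  obtain ⟨C, ε, hε, hC⟩ := hcomplex
  refine ⟨C, ε, hε, fun t ht => ?_⟩
  have ha := GeometricGrowth.of_aeval_leftShift_eq_zero hq h
  have hbound := hC t ht
  rwa [expSum_map ha Complex.ofRealCLM, Complex.ofRealCLM_apply, Complex.norm_real] at hbound

theorem ExpDecay.tendsto_zero {E : Type*} [SeminormedAddGroup E] {h : ℝ → E} (hh : ExpDecay h) :
    Filter.Tendsto h Filter.atTop (nhds 0) := by
  obtain ⟨C, ε, hε, hC⟩ := hh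
  have hexp : Filter.Tendsto (fun t => C * Real.exp (-ε * t)) Filter.atTop (nhds 0) := by
    simpa using (Real.tendsto_exp_atBot.comp
      (Filter.tendsto_id.const_mul_atTop_of_neg (neg_neg_of_pos hε))).const_mul C
  refine squeeze_zero_norm' ?_ hexp
  filter_upwards [Filter.eventually_ge_atTop 0] with t ht using hC t ht

theorem ExpDecay.integrableOn_norm {E : Type*} [NormedAddCommGroup E] {h : ℝ → E}
    (hh : ExpDecay h) (hc : Continuous h) :
    MeasureTheory.IntegrableOn (fun t => ‖h t‖) (Set.Ioi 0) := by
  obtain ⟨C, ε, hε, hC⟩ := hh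
  refine ((exp_neg_integrableOn_Ioi 0 hε).const_mul C).mono' hc.norm.aestronglyMeasurable ?_
  filter_upwards [MeasureTheory.ae_restrict_mem measurableSet_Ioi] with t ht
  simpa using hC t (le_of_lt ht)

end Decay

section Gain

variable {G H : RatFunc ℝ}

theorem expDecay_impulse (hG : G ∈ properTransfer) (hs : Stable G) : ExpDecay (impulse G) :=
  impulse_eq_expSum G ▸ expDecay_expSum (RatFunc.monic_denom G) hs
    (aeval_leftShift_denom_expansion hG)

theorem l1Gain_nonneg (G : RatFunc ℝ) : 0 ≤ l1Gain G :=
  add_nonneg (abs_nonneg _) (MeasureTheory.integral_nonneg fun _ => abs_nonneg _)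

theorem abs_integral_convolution_le {h v : ℝ → ℝ} (hc : Continuous h)
    (hi : MeasureTheory.IntegrableOn (fun t => |h t|) (Set.Ioi 0)) {t M : ℝ} (ht : 0 ≤ t)
    (hv : ∀ s ∈ Set.Icc 0 t, |v s| ≤ M) :
    |∫ s in (0 : ℝ)..t, h (t - s) * v s| ≤ (∫ s in Set.Ioi (0 : ℝ), |h s|) * M := by
  have hM : 0 ≤ M := (abs_nonneg _).trans (hv 0 ⟨le_rfl, ht⟩)
  calc |∫ s in (0 : ℝ)..t, h (t - s) * v s| ≤ ∫ s in (0 : ℝ)..t, |h (t - s)| * M := by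
        refine intervalIntegral.norm_integral_le_of_norm_le (E := ℝ) ht
          (.of_forall fun s hs => ?_) (Continuous.intervalIntegrable (by fun_prop) _ _)
        rw [norm_mul]
        exact mul_le_mul_of_nonneg_left (hv s ⟨hs.1.le, hs.2⟩) (norm_nonneg _)
    _ = (∫ s in Set.Ioc (0 : ℝ) t, |h s|) * M := by
        rw [intervalIntegral.integral_mul_const, intervalIntegral.integral_comp_sub_left
          (fun s => |h s|) t, sub_self, sub_zero, intervalIntegral.integral_of_le ht]
    _ ≤ (∫ s in Set.Ioi (0 : ℝ), |h s|) * M := by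
        gcongr
        · exact .of_forall fun _ => abs_nonneg _
        · exact Set.Ioc_subset_Ioi_self

theorem abs_response_le (hG : G ∈ properTransfer) (hs : Stable G) {v : ℝ → ℝ} {t M : ℝ}
    (ht : 0 ≤ t) (hv : ∀ s ∈ Set.Icc 0 t, |v s| ≤ M) : |response G v t| ≤ l1Gain G * M := by
  rw [response, l1Gain, add_mul]
  refine (abs_add_le _ _).trans (add_le_add ?_ ?_)
  · rw [abs_mul]
    exact mul_le_mul_of_nonneg_left (hv t ⟨ht, le_rfl⟩) (abs_nonneg _)
  · exact abs_integral_convolution_le (continuous_impulse hG)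
      ((expDecay_impulse hG hs).integrableOn_norm (continuous_impulse hG)) ht hv

theorem StablePoly.of_dvd {p q : ℝ[X]} (hq : StablePoly q) (h : p ∣ q) : StablePoly p := by
  obtain ⟨r, rfl⟩ := h
  exact ⟨left_ne_zero_of_mul hq.1, fun z hz => hq.2 z (by rw [map_mul, hz, zero_mul])⟩

theorem StablePoly.mul {p q : ℝ[X]} (hp : StablePoly p) (hq : StablePoly q) :
    StablePoly (p * q) := by
  refine ⟨mul_ne_zero hp.1 hq.1, fun z hz => ?_⟩
  rw [map_mul] at hz
  exact (mul_eq_zero.mp hz).elim (hp.2 z) (hq.2 z)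

theorem stable_div (p : ℝ[X]) {q : ℝ[X]} (hq : StablePoly q) :
    Stable (algebraMap ℝ[X] (RatFunc ℝ) p / algebraMap ℝ[X] (RatFunc ℝ) q) :=
  hq.of_dvd (RatFunc.denom_div_dvd p q)

theorem Stable.mul (hG : Stable G) (hH : Stable H) : Stable (G * H) :=
  (StablePoly.mul hG hH).of_dvd (RatFunc.denom_mul_dvd G H)

theorem Stable.add (hG : Stable G) (hH : Stable H) : Stable (G + H) :=
  (StablePoly.mul hG hH).of_dvd (RatFunc.denom_add_dvd G H)

theorem stable_C (a : ℝ) : Stable (RatFunc.C a) := by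
  rw [Stable, RatFunc.denom_C]
  exact ⟨one_ne_zero, fun z hz => by simp at hz⟩

end Gain

/-! ### State space systems -/

section StateSpace

variable {ι : Type*} [Fintype ι] [DecidableEq ι] (A : Matrix ι ι ℝ) (b : ι → ℝ)

/-- The numerators `adj (s I - A) b` of `(s I - A)⁻¹ b`. -/
def stateNum : ι → ℝ[X] := A.charmatrix.adjugate *ᵥ fun j => Polynomial.C (b j)

/-- The transfer functions `(s I - A)⁻¹ b` from the input to the state of `y' = A y + v b`. -/
def stateTransfer : ι → RatFunc ℝ :=
  (Matrix.scalar ι (RatFunc.X : RatFunc ℝ) - A.map RatFunc.C)⁻¹ *ᵥ fun j => RatFunc.C (b j)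

theorem map_charmatrix : A.charmatrix.map (algebraMap ℝ[X] (RatFunc ℝ)) =
    Matrix.scalar ι (RatFunc.X : RatFunc ℝ) - A.map RatFunc.C := by
  ext i j
  by_cases h : i = j
  · subst h
    simp
  · simp [h]

theorem X_smul_stateNum : (Polynomial.X : ℝ[X]) • stateNum A b =
    A.map Polynomial.C *ᵥ stateNum A b + A.charpoly • fun i => Polynomial.C (b i) := by
  have hadj : A.charmatrix *ᵥ stateNum A b = A.charpoly • fun i => Polynomial.C (b i) := by
    rw [stateNum, Matrix.mulVec_mulVec, Matrix.mul_adjugate, Matrix.smul_mulVec,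
      Matrix.one_mulVec, Matrix.charpoly]
  rw [← hadj, ← Matrix.add_mulVec, Matrix.charmatrix, RingHom.mapMatrix_apply, add_sub_cancel,
    Matrix.scalar_apply, Matrix.diagonal_const_mulVec]

theorem X_smul_stateTransfer : (RatFunc.X : RatFunc ℝ) • stateTransfer A b =
    A.map RatFunc.C *ᵥ stateTransfer A b + fun i => RatFunc.C (b i) := by
  have hdet : IsUnit (Matrix.scalar ι (RatFunc.X : RatFunc ℝ) - A.map RatFunc.C).det := by
    rw [← map_charmatrix, ← RingHom.mapMatrix_apply, ← RingHom.map_det, isUnit_iff_ne_zero]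
    exact RatFunc.algebraMap_ne_zero A.charpoly_monic.ne_zero
  have hinv : (Matrix.scalar ι (RatFunc.X : RatFunc ℝ) - A.map RatFunc.C) *ᵥ stateTransfer A b =
      fun i => RatFunc.C (b i) := by
    rw [stateTransfer, Matrix.mulVec_mulVec, Matrix.mul_nonsing_inv _ hdet, Matrix.one_mulVec]
  rw [← hinv, ← Matrix.add_mulVec, add_sub_cancel, Matrix.scalar_apply,
    Matrix.diagonal_const_mulVec]

theorem stateTransfer_eq_div (i : ι) : stateTransfer A b i =
    algebraMap ℝ[X] (RatFunc ℝ) (stateNum A b i) / algebraMap ℝ[X] (RatFunc ℝ) A.charpoly := by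
  have hb : (fun j => RatFunc.C (b j)) =
      algebraMap ℝ[X] (RatFunc ℝ) ∘ fun j => Polynomial.C (b j) :=
    funext fun j => (RatFunc.algebraMap_C (b j)).symm
  rw [stateTransfer, ← map_charmatrix, Matrix.inv_def, Matrix.smul_mulVec, Pi.smul_apply,
    ← RingHom.mapMatrix_apply, ← RingHom.map_det, ← RingHom.map_adjugate, hb,
    RingHom.mapMatrix_apply, ← RingHom.map_mulVec, Ring.inverse_eq_inv', smul_eq_mul,
    div_eq_inv_mul]
  rfl

-- In `s N = A N + χ b` the degree of a component of `N` of maximal degree goes up by one on the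
-- left, while on the right it can only be exceeded by `deg χ`.
theorem natDegree_stateNum_lt (i : ι) : (stateNum A b i).natDegree < Fintype.card ι := by
  have : Nonempty ι := ⟨i⟩
  obtain ⟨j, hj⟩ := Finite.exists_max fun i => (stateNum A b i).natDegree
  refine (hj i).trans_lt ?_
  by_cases h0 : stateNum A b j = 0
  · rw [h0, Polynomial.natDegree_zero]
    exact Fintype.card_pos
  have hX : Polynomial.X * stateNum A b j =
      ∑ k, Polynomial.C (A j k) * stateNum A b k + A.charpoly * Polynomial.C (b j) :=
    congrFun (X_smul_stateNum A b) j
  have hdeg : (Polynomial.X * stateNum A b j).natDegree ≤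
      max (stateNum A b j).natDegree (Fintype.card ι) := by
    rw [hX]
    refine Polynomial.natDegree_add_le_of_degree_le
      (Polynomial.natDegree_sum_le_of_forall_le _ _ fun k _ => ?_) ?_
    · exact (Polynomial.natDegree_C_mul_le _ _).trans ((hj k).trans (le_max_left _ _))
    · exact (Polynomial.natDegree_mul_C_le _ _).trans
        (A.charpoly_natDegree_eq_dim.le.trans (le_max_right _ _))
  rw [Polynomial.natDegree_X_mul h0] at hdeg
  lia

theorem stateTransfer_mem_properTransfer (i : ι) : stateTransfer A b i ∈ properTransfer := by
  rw [stateTransfer_eq_div]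
  exact div_mem_properTransfer A.charpoly_monic.ne_zero
    (by rw [A.charpoly_natDegree_eq_dim]; exact (natDegree_stateNum_lt A b i).le)

variable {T : ℝ≥0} {A b}

variable (A b) in
/-- The state of `y' = A y + v b`, `y(0) = 0`, as a family of signals: the action of
`stateTransfer` on the input `v`. -/
def stateSignal (v : Signal T) (i : ι) : Signal T :=
  transferOp T ⟨stateTransfer A b i, stateTransfer_mem_properTransfer A b i⟩ v

theorem stateSignal_eq_volterra (v : Signal T) (i : ι) :
    stateSignal A b v i = volterra T (∑ j, A i j • stateSignal A b v j + b i • v) := by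
  have htransfer : (⟨stateTransfer A b i, stateTransfer_mem_properTransfer A b i⟩ :
      properTransfer) = ⟨RatFunc.X⁻¹, inv_X_mem_properTransfer⟩ *
        (∑ j, A i j • ⟨stateTransfer A b j, stateTransfer_mem_properTransfer A b j⟩ +
          b i • 1) := by
    ext1
    have hi := congrFun (X_smul_stateTransfer A b) i
    simp only [Pi.smul_apply, Pi.add_apply, smul_eq_mul, Matrix.mulVec, dotProduct,
      Matrix.map_apply] at hi
    push_cast
    simp only [Algebra.smul_def, RatFunc.algebraMap_eq_C, mul_one]
    rw [← hi, inv_mul_cancel_left₀ RatFunc.X_ne_zero]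
  rw [stateSignal, htransfer, map_mul, transferOp_inv_X]
  simp only [stateSignal, map_add, map_sum, map_smul, map_one, mul_apply_eq_comp,
    add_apply, FunLike.coe_sum, Finset.sum_apply,
    smul_apply, one_apply_eq_self]

theorem hasDerivWithinAt_stateSignal {v : Signal T} {w : ℝ → ℝ} (hv : ∀ t, v t = w t) {t : ℝ}
    (ht : t ∈ Set.Ico (0 : ℝ) T) :
    HasDerivWithinAt (fun s i => (stateSignal A b v i).IccExtend T.2 s)
      (A *ᵥ (fun i => (stateSignal A b v i).IccExtend T.2 t) + w t • b) (Set.Ici t) t := by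
  refine hasDerivWithinAt_pi.mpr fun i => ?_
  set f : Signal T := ∑ j, A i j • stateSignal A b v j + b i • v
  have hderiv : HasDerivAt (fun s => ∫ τ in (0 : ℝ)..s, f.IccExtend T.2 τ)
      (f.IccExtend T.2 t) t :=
    intervalIntegral.integral_hasDerivAt_right ((map_continuous _).intervalIntegrable _ _)
      ((map_continuous _).stronglyMeasurableAtFilter _ _) (map_continuous _).continuousAt
  have hft : f.IccExtend T.2 t =
      (A *ᵥ (fun i => (stateSignal A b v i).IccExtend T.2 t) + w t • b) i := by
    have hmem := Set.Ico_subset_Icc_self ht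
    simp only [IccExtend_of_mem _ hmem, Pi.add_apply, Pi.smul_apply, Matrix.mulVec, dotProduct]
    simp [f, hv, mul_comm (b i)]
  rw [← hft]
  have hEqOn : Set.EqOn ((stateSignal A b v i).IccExtend T.2)
      (fun s => ∫ τ in (0 : ℝ)..s, f.IccExtend T.2 τ) (Set.Icc 0 T) :=
    IccExtend_eqOn fun s => by rw [stateSignal_eq_volterra, volterra_apply]
  refine hderiv.hasDerivWithinAt.congr_of_eventuallyEq ?_ (hEqOn (Set.Ico_subset_Icc_self ht))
  filter_upwards [Icc_mem_nhdsGE ht.2] with s hs using hEqOn ⟨ht.1.trans hs.1, hs.2⟩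

theorem eq_stateSignal_of_hasDerivWithinAt {y : ℝ → ι → ℝ} {w : ℝ → ℝ} (h0 : y 0 = 0)
    (hy : ∀ t, 0 ≤ t → HasDerivWithinAt y (A *ᵥ y t + w t • b) (Set.Ici 0) t) {v : Signal T}
    (hv : ∀ t, v t = w t) (i : ι) (t : Set.Icc (0 : ℝ) T) : stateSignal A b v i t = y t i := by
  have hlip : ∀ s, LipschitzWith (‖(Matrix.mulVecLin A).toContinuousLinearMap‖₊ + 0)
      fun z => A *ᵥ z + w s • b := fun s =>
    (Matrix.mulVecLin A).toContinuousLinearMap.lipschitz.add (LipschitzWith.const (w s • b))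
  have heq := ODE_solution_unique (a := 0) (b := T) hlip
    (f := fun s i => (stateSignal A b v i).IccExtend T.2 s) (g := y)
    (Continuous.continuousOn (by fun_prop)) (fun s hs => hasDerivWithinAt_stateSignal hv hs)
    (fun s hs => (hy s hs.1).continuousWithinAt.mono fun _ h => h.1)
    (fun s hs => (hy s hs.1).mono (Set.Ici_subset_Ici.mpr hs.1))
    (funext fun i => by
      rw [IccExtend_of_mem _ (Set.left_mem_Icc.mpr T.2), stateSignal_eq_volterra, volterra_apply]
      simp [h0])
  exact (IccExtend_of_mem _ t.2).symm.trans (congrFun (heq t.2) i)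

end StateSpace

/-! ### The linear flow of a Hurwitz matrix and the Lyapunov equation -/

section Flow

variable {ι : Type*} [Fintype ι]

theorem hasDerivWithinAt_dotProduct {x y : ℝ → ι → ℝ} {x' y' : ι → ℝ} {s : Set ℝ} {t : ℝ}
    (hx : HasDerivWithinAt x x' s t) (hy : HasDerivWithinAt y y' s t) :
    HasDerivWithinAt (fun t => x t ⬝ᵥ y t) (x' ⬝ᵥ y t + x t ⬝ᵥ y') s t := by
  have h := HasDerivWithinAt.fun_sum (u := Finset.univ) fun i _ =>
    (hasDerivWithinAt_pi.mp hx i).mul (hasDerivWithinAt_pi.mp hy i)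
  exact h.congr_deriv Finset.sum_add_distrib

theorem hasDerivWithinAt_mulVec (M : Matrix ι ι ℝ) {y : ℝ → ι → ℝ} {y' : ι → ℝ} {s : Set ℝ}
    {t : ℝ} (hy : HasDerivWithinAt y y' s t) :
    HasDerivWithinAt (fun t => M *ᵥ y t) (M *ᵥ y') s t :=
  M.mulVecLin.toContinuousLinearMap.hasFDerivAt.comp_hasDerivWithinAt t hy

variable [DecidableEq ι]

theorem aeval_leftShift_charpoly (A : Matrix ι ι ℝ) (w : ι → ℝ) :
    Polynomial.aeval (leftShift ℝ (ι → ℝ)) A.charpoly (fun k => (A ^ k) *ᵥ w) = 0 := by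
  funext k
  have hCH := congrArg (fun M => (A ^ k * M) *ᵥ w) A.aeval_self_charpoly
  simp only [Polynomial.aeval_eq_sum_range, Finset.mul_sum, Matrix.mul_smul, ← pow_add,
    Matrix.sum_mulVec, Matrix.smul_mulVec, mul_zero, Matrix.zero_mulVec] at hCH
  rw [aeval_leftShift_apply, hCH, Pi.zero_apply]

theorem geometricGrowth_pow_mulVec (A : Matrix ι ι ℝ) (w : ι → ℝ) :
    GeometricGrowth fun k => (A ^ k) *ᵥ w :=
  .of_aeval_leftShift_eq_zero A.charpoly_monic (aeval_leftShift_charpoly A w)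

/-- The solution `exp (t A) w` of the linear system `x' = A x`, `x 0 = w`, along which quadratic
forms are differentiated in the study of the Lyapunov equation. It is defined by its power series
so that the decay estimates for `expSum` apply to it. -/
def flow (A : Matrix ι ι ℝ) (w : ι → ℝ) (t : ℝ) : ι → ℝ :=
  expSum (fun k => (A ^ k) *ᵥ w) t

theorem flow_zero_right (A : Matrix ι ι ℝ) (w : ι → ℝ) : flow A w 0 = w := by
  rw [flow, expSum_zero_right, pow_zero, Matrix.one_mulVec]

theorem hasDerivAt_flow (A : Matrix ι ι ℝ) (w : ι → ℝ) (t : ℝ) :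
    HasDerivAt (flow A w) (A *ᵥ flow A w t) t := by
  have hgrowth := geometricGrowth_pow_mulVec A w
  refine (hgrowth.hasDerivAt_expSum t).congr_deriv ?_
  simp only [pow_succ', ← Matrix.mulVec_mulVec]
  exact expSum_map hgrowth A.mulVecLin.toContinuousLinearMap t

theorem hasDerivAt_flow_form (A M : Matrix ι ι ℝ) (v w : ι → ℝ) (t : ℝ) :
    HasDerivAt (fun t => flow A v t ⬝ᵥ (M *ᵥ flow A w t))
      (flow A v t ⬝ᵥ ((Aᵀ * M + M * A) *ᵥ flow A w t)) t := by
  have hv := (hasDerivAt_flow A v t).hasDerivWithinAt (s := Set.univ)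
  have hw := (hasDerivAt_flow A w t).hasDerivWithinAt (s := Set.univ)
  rw [← hasDerivWithinAt_univ]
  refine (hasDerivWithinAt_dotProduct hv (hasDerivWithinAt_mulVec M hw)).congr_deriv ?_
  rw [Matrix.add_mulVec, dotProduct_add, ← Matrix.mulVec_mulVec, ← Matrix.mulVec_mulVec,
    Matrix.dotProduct_mulVec _ Aᵀ, Matrix.vecMul_transpose]

variable {n : ℕ} {A : Matrix (Fin n) (Fin n) ℝ}

theorem stablePoly_charpoly (hA : IsHurwitz A) : StablePoly A.charpoly := by
  refine ⟨A.charpoly_monic.ne_zero, fun z hz => hA z ?_⟩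
  rwa [Matrix.mem_spectrum_iff_isRoot_charpoly, Matrix.charpoly_map, Polynomial.IsRoot.def,
    Polynomial.eval_map_algebraMap]

theorem stable_stateTransfer (hA : IsHurwitz A) (b : Fin n → ℝ) (i : Fin n) :
    Stable (stateTransfer A b i) := by
  rw [stateTransfer_eq_div]
  exact stable_div _ (stablePoly_charpoly hA)

theorem tendsto_flow (hA : IsHurwitz A) (w : Fin n → ℝ) :
    Filter.Tendsto (flow A w) Filter.atTop (nhds 0) := by
  refine tendsto_pi_nhds.mpr fun i => ?_
  have hcoord : (fun t => flow A w t i) = expSum fun k => ((A ^ k) *ᵥ w) i := funext fun t =>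
    (expSum_map (geometricGrowth_pow_mulVec A w)
      (ContinuousLinearMap.proj (R := ℝ) (φ := fun _ : Fin n => ℝ) i) t).symm
  have hrec : Polynomial.aeval (leftShift ℝ ℝ) A.charpoly (fun k => ((A ^ k) *ᵥ w) i) = 0 := by
    funext k
    have h := congrFun (congrFun (aeval_leftShift_charpoly A w) k) i
    simpa [aeval_leftShift_apply] using h
  rw [hcoord]
  exact (expDecay_expSum A.charpoly_monic (stablePoly_charpoly hA) hrec).tendsto_zero

theorem tendsto_flow_form (hA : IsHurwitz A) (M : Matrix (Fin n) (Fin n) ℝ) (v w : Fin n → ℝ) :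
    Filter.Tendsto (fun t => flow A v t ⬝ᵥ (M *ᵥ flow A w t)) Filter.atTop (nhds 0) := by
  have hc : Continuous fun p : (Fin n → ℝ) × (Fin n → ℝ) => p.1 ⬝ᵥ (M *ᵥ p.2) := by fun_prop
  have h := (hc.tendsto (0, 0)).comp ((tendsto_flow hA v).prodMk_nhds (tendsto_flow hA w))
  simpa [Function.comp_def] using h

variable {P Q : Matrix (Fin n) (Fin n) ℝ}

theorem lyapunov_isSymm (hA : IsHurwitz A) (hQ : Qᵀ = Q) (hP : Aᵀ * P + P * A = -Q) :
    Pᵀ = P := by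
  have hD : Aᵀ * (Pᵀ - P) + (Pᵀ - P) * A = 0 := by
    have h1 := congrArg Matrix.transpose hP
    simp only [Matrix.transpose_add, Matrix.transpose_mul, Matrix.transpose_transpose,
      Matrix.transpose_neg, hQ] at h1
    rw [mul_sub, sub_mul]
    calc _ = (Pᵀ * A + Aᵀ * Pᵀ) - (Aᵀ * P + P * A) := by abel
      _ = 0 := by rw [h1, hP, sub_self]
  have hform : ∀ v w : Fin n → ℝ, v ⬝ᵥ ((Pᵀ - P) *ᵥ w) = 0 := by
    intro v w
    have hd := fun t => hasDerivAt_flow_form A (Pᵀ - P) v w t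
    simp only [hD, Matrix.zero_mulVec, dotProduct_zero] at hd
    have hconst := fun t => is_const_of_deriv_eq_zero (fun t => (hd t).differentiableAt)
      (fun t => (hd t).deriv) t 0
    have hlim := tendsto_flow_form hA (Pᵀ - P) v w
    simp only [hconst, flow_zero_right] at hlim
    exact tendsto_nhds_unique tendsto_const_nhds hlim
  rw [← sub_eq_zero]
  ext i j
  simpa using hform (Pi.single i 1) (Pi.single j 1)

theorem lyapunov_nonneg (hA : IsHurwitz A) (hQ : Q.PosDef) (hP : Aᵀ * P + P * A = -Q)
    (w : Fin n → ℝ) : 0 ≤ w ⬝ᵥ (P *ᵥ w) := by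
  have hd := fun t => hasDerivAt_flow_form A P w w t
  have hanti : Antitone fun t => flow A w t ⬝ᵥ (P *ᵥ flow A w t) := by
    refine antitone_of_deriv_nonpos (fun t => (hd t).differentiableAt) fun t => ?_
    rw [(hd t).deriv, hP, Matrix.neg_mulVec, dotProduct_neg]
    have := hQ.posSemidef.dotProduct_mulVec_nonneg (flow A w t)
    simp only [star_trivial] at this
    linarith
  have := hanti.le_of_tendsto (tendsto_flow_form hA P w w) 0
  simpa [flow_zero_right] using this

theorem lyapunov_posDef (hA : IsHurwitz A) (hQ : Q.PosDef) (hP : Aᵀ * P + P * A = -Q) :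
    P.PosDef := by
  have hQT : Qᵀ = Q := by simpa using hQ.isHermitian.eq
  refine Matrix.PosDef.of_dotProduct_mulVec_pos ?_ fun w hw => ?_
  · simpa [Matrix.IsHermitian] using lyapunov_isSymm hA hQT hP
  rw [star_trivial]
  refine lt_of_le_of_ne (lyapunov_nonneg hA hQ hP w) fun h0 => ?_
  have hmin : IsLocalMin (fun t => flow A w t ⬝ᵥ (P *ᵥ flow A w t)) 0 := by
    refine Filter.Eventually.of_forall fun t => ?_
    simp only [flow_zero_right, ← h0]
    exact lyapunov_nonneg hA hQ hP _
  have hz := hmin.hasDerivAt_eq_zero (hasDerivAt_flow_form A P w w 0)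
  rw [hP, flow_zero_right, Matrix.neg_mulVec, dotProduct_neg] at hz
  have := hQ.dotProduct_mulVec_pos hw
  simp only [star_trivial] at this
  linarith

theorem lamMin_mul_le {M : Matrix (Fin n) (Fin n) ℝ} (hM : M.IsHermitian) (x : Fin n → ℝ) :
    lamMin M * (x ⬝ᵥ x) ≤ x ⬝ᵥ (M *ᵥ x) := by
  have hfin : (spectrum ℝ M).Finite := M.finite_spectrum
  have hH : (M - algebraMap ℝ (Matrix (Fin n) (Fin n) ℝ) (lamMin M)).IsHermitian := by
    refine hM.sub ?_
    rw [Matrix.algebraMap_eq_diagonal]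
    exact Matrix.isHermitian_diagonal _
  have hpsd := hH.posSemidef_iff_eigenvalues_nonneg.mpr fun i => by
    have h1 := hH.eigenvalues_mem_spectrum_real i
    rw [← spectrum.sub_singleton_eq] at h1
    obtain ⟨μ, hμ, c, hc, h⟩ := Set.mem_sub.mp h1
    rw [Set.mem_singleton_iff] at hc
    rw [← h, hc, Pi.zero_apply, sub_nonneg]
    exact csInf_le hfin.bddBelow hμ
  have h2 := hpsd.dotProduct_mulVec_nonneg x
  rw [star_trivial, Matrix.sub_mulVec, dotProduct_sub, Algebra.algebraMap_eq_smul_one,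
    Matrix.smul_mulVec, Matrix.one_mulVec, dotProduct_smul, smul_eq_mul] at h2
  linarith

theorem le_lamMax_mul {M : Matrix (Fin n) (Fin n) ℝ} (hM : M.IsHermitian) (x : Fin n → ℝ) :
    x ⬝ᵥ (M *ᵥ x) ≤ lamMax M * (x ⬝ᵥ x) := by
  have h := lamMin_mul_le hM.neg x
  have hneg : lamMin (-M) = -lamMax M := by
    unfold lamMin lamMax
    rw [← spectrum.neg_eq, Real.sInf_def, neg_neg]
  rw [hneg, Matrix.neg_mulVec, dotProduct_neg] at h
  linarith

theorem pos_of_mem_spectrum_of_posDef {M : Matrix (Fin n) (Fin n) ℝ} (hM : M.PosDef) {μ : ℝ}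
    (hμ : μ ∈ spectrum ℝ M) : 0 < μ := by
  rw [hM.isHermitian.spectrum_real_eq_range_eigenvalues] at hμ
  obtain ⟨i, rfl⟩ := hμ
  exact hM.eigenvalues_pos i

theorem spectrum_nonempty_of_isHermitian (hn : 0 < n) {M : Matrix (Fin n) (Fin n) ℝ}
    (hM : M.IsHermitian) : (spectrum ℝ M).Nonempty :=
  ⟨_, hM.eigenvalues_mem_spectrum_real ⟨0, hn⟩⟩

theorem lamMin_pos (hn : 0 < n) {M : Matrix (Fin n) (Fin n) ℝ} (hM : M.PosDef) : 0 < lamMin M :=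
  pos_of_mem_spectrum_of_posDef hM
    ((spectrum_nonempty_of_isHermitian hn hM.isHermitian).csInf_mem M.finite_spectrum)

theorem lamMax_pos (hn : 0 < n) {M : Matrix (Fin n) (Fin n) ℝ} (hM : M.PosDef) : 0 < lamMax M :=
  pos_of_mem_spectrum_of_posDef hM
    ((spectrum_nonempty_of_isHermitian hn hM.isHermitian).csSup_mem M.finite_spectrum)

end Flow

/-! ### Outputs of relative degree one -/

section Output

variable {ι : Type*} [Fintype ι] [DecidableEq ι] {A : Matrix ι ι ℝ} {b v : ι → ℝ}

/-- The numerator `det (s I - A) vᵀ (s I - A)⁻¹ b` of the transfer function from the input to the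
output `vᵀ x`, as a linear map in `v`. -/
def outputNum (A : Matrix ι ι ℝ) (b : ι → ℝ) : (ι → ℝ) →ₗ[ℝ] ℝ[X] :=
  Fintype.linearCombination ℝ (stateNum A b)

theorem outputNum_apply (A : Matrix ι ι ℝ) (b v : ι → ℝ) :
    outputNum A b v = (fun i => Polynomial.C (v i)) ⬝ᵥ stateNum A b := by
  simp only [outputNum, Fintype.linearCombination_apply, Polynomial.smul_eq_C_mul, dotProduct]

theorem outputNum_mem_degreeLT (A : Matrix ι ι ℝ) (b v : ι → ℝ) :
    outputNum A b v ∈ Polynomial.degreeLT ℝ (Fintype.card ι) := by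
  rw [outputNum, Fintype.linearCombination_apply]
  refine Submodule.sum_mem _ fun i _ => Submodule.smul_mem _ _ (Polynomial.mem_degreeLT.mpr ?_)
  exact Polynomial.degree_le_natDegree.trans_lt (by exact_mod_cast natDegree_stateNum_lt A b i)

theorem X_mul_outputNum (A : Matrix ι ι ℝ) (b v : ι → ℝ) :
    Polynomial.X * outputNum A b v =
      outputNum A b (v ᵥ* A) + A.charpoly * Polynomial.C (v ⬝ᵥ b) := by
  have hvec : (fun i => Polynomial.C ((v ᵥ* A) i)) = (fun i => Polynomial.C (v i)) ᵥ* A.map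
      Polynomial.C := funext fun i => RingHom.map_vecMul Polynomial.C A v i
  have hdot : Polynomial.C (v ⬝ᵥ b) =
      (fun i => Polynomial.C (v i)) ⬝ᵥ fun i => Polynomial.C (b i) :=
    RingHom.map_dotProduct Polynomial.C v b
  rw [outputNum_apply, outputNum_apply, ← smul_eq_mul, ← dotProduct_smul, X_smul_stateNum,
    dotProduct_add, Matrix.dotProduct_mulVec, hvec, hdot, dotProduct_smul, smul_eq_mul]

theorem dotProduct_eq_zero_of_outputNum_eq_zero (h : outputNum A b v = 0) : v ⬝ᵥ b = 0 := by
  have hcoeff := congrArg (fun p => p.coeff (Fintype.card ι)) (X_mul_outputNum A b v)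
  have hlow : (outputNum A b (v ᵥ* A)).coeff (Fintype.card ι) = 0 :=
    Polynomial.coeff_eq_zero_of_degree_lt
      (Polynomial.mem_degreeLT.mp (outputNum_mem_degreeLT A b (v ᵥ* A)))
  have hlead : A.charpoly.coeff (Fintype.card ι) = 1 := by
    rw [← A.charpoly_natDegree_eq_dim]
    exact A.charpoly_monic.coeff_natDegree
  simpa [h, hlow, hlead] using hcoeff.symm

theorem outputNum_vecMul_pow_eq_zero (h : outputNum A b v = 0) (k : ℕ) :
    outputNum A b (v ᵥ* A ^ k) = 0 := by
  induction k with
  | zero => simpa using h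
  | succ k ih =>
    have hX := X_mul_outputNum A b (v ᵥ* A ^ k)
    rw [ih, dotProduct_eq_zero_of_outputNum_eq_zero ih] at hX
    simpa [Matrix.vecMul_vecMul, ← pow_succ] using hX.symm

theorem vecMul_pow_add_vecMulVec (K : ι → ℝ) (h : ∀ k : ℕ, v ᵥ* A ^ k ⬝ᵥ b = 0) (k : ℕ) :
    v ᵥ* (A + Matrix.vecMulVec b K) ^ k = v ᵥ* A ^ k := by
  induction k with
  | zero => rfl
  | succ k ih =>
    rw [pow_succ, ← Matrix.vecMul_vecMul, ih, Matrix.vecMul_add, Matrix.vecMul_vecMul, ← pow_succ,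
      Matrix.vecMul_vecMulVec, h, zero_smul, add_zero]

end Output

section MinPhase

variable {n : ℕ} {A : Matrix (Fin n) (Fin n) ℝ} {b K : Fin n → ℝ}

theorem IsControllable.eq_zero_of_forall_dotProduct {v : Fin n → ℝ} (hctrl : IsControllable A b)
    (h : ∀ k : ℕ, v ᵥ* A ^ k ⬝ᵥ b = 0) : v = 0 := by
  have hker : Submodule.span ℝ (Set.range fun k : Fin n => (A ^ (k : ℕ)) *ᵥ b) ≤
      LinearMap.ker (dotProductBilin ℝ ℝ v) :=
    Submodule.span_le.mpr <| Set.range_subset_iff.mpr fun k => by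
      simpa [Matrix.dotProduct_mulVec] using h k
  rw [hctrl] at hker
  exact dotProduct_self_eq_zero.mp (hker (Submodule.mem_top (x := v)))

theorem injective_outputNum_Am (hctrl : IsControllable A b) (K : Fin n → ℝ) :
    Function.Injective (outputNum (Am A b K) b) := by
  refine (injective_iff_map_eq_zero _).mpr fun v hv =>
    hctrl.eq_zero_of_forall_dotProduct fun k => ?_
  have hm (k : ℕ) : v ᵥ* Am A b K ^ k ⬝ᵥ b = 0 :=
    dotProduct_eq_zero_of_outputNum_eq_zero (outputNum_vecMul_pow_eq_zero hv k)
  rw [← hm k, ← vecMul_pow_add_vecMulVec K hm k, Am, sub_add_cancel]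

theorem range_outputNum_Am (hctrl : IsControllable A b) (K : Fin n → ℝ) :
    LinearMap.range (outputNum (Am A b K) b) = Polynomial.degreeLT ℝ n := by
  have : FiniteDimensional ℝ (Polynomial.degreeLT ℝ n) :=
    (Polynomial.degreeLTEquiv ℝ n).symm.finiteDimensional
  refine Submodule.eq_of_le_of_finrank_eq ?_ ?_
  · rintro _ ⟨v, rfl⟩
    simpa using outputNum_mem_degreeLT (Am A b K) b v
  · rw [LinearMap.finrank_range_of_inj (injective_outputNum_Am hctrl K),
      (Polynomial.degreeLTEquiv ℝ n).finrank_eq]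

theorem vecHo_eq_div (A : Matrix (Fin n) (Fin n) ℝ) (b K v : Fin n → ℝ) : vecHo A b K v =
    algebraMap ℝ[X] (RatFunc ℝ) (outputNum (Am A b K) b v) /
      algebraMap ℝ[X] (RatFunc ℝ) (Am A b K).charpoly := by
  rw [outputNum_apply, dotProduct, map_sum, Finset.sum_div]
  refine Finset.sum_congr rfl fun i _ => ?_
  rw [map_mul, RatFunc.algebraMap_C, mul_div_assoc]
  exact congrArg _ (stateTransfer_eq_div _ _ _)

theorem stablePoly_X_add_one_pow (m : ℕ) : StablePoly ((Polynomial.X + Polynomial.C 1) ^ m) := by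
  refine ⟨pow_ne_zero _ (Polynomial.X_add_C_ne_zero 1), fun z hz => ?_⟩
  simp only [map_one, map_pow, map_add, Polynomial.aeval_X] at hz
  have hz' : z = -1 := eq_neg_of_add_eq_zero_left (eq_zero_of_pow_eq_zero hz)
  simp [hz']

theorem exists_isMinPhaseOutput (hn : 0 < n) (hctrl : IsControllable A b)
    (hK : IsHurwitz (Am A b K)) : ∃ co : Fin n → ℝ, IsMinPhaseOutput A b K co := by
  set N : ℝ[X] := (Polynomial.X + Polynomial.C 1) ^ (n - 1) with hN
  have hdeg : N.natDegree = n - 1 := by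
    rw [hN, Polynomial.natDegree_pow, Polynomial.natDegree_X_add_C, mul_one]
  have hmem : N ∈ LinearMap.range (outputNum (Am A b K) b) := by
    rw [range_outputNum_Am hctrl, Polynomial.mem_degreeLT]
    refine Polynomial.degree_le_natDegree.trans_lt ?_
    rw [hdeg]
    exact_mod_cast Nat.sub_lt hn one_pos
  obtain ⟨co, hco⟩ := hmem
  refine ⟨co, N, (Am A b K).charpoly, stablePoly_X_add_one_pow _, stablePoly_charpoly hK, ?_, ?_⟩
  · rw [hdeg, Matrix.charpoly_natDegree_eq_dim, Fintype.card_fin, Nat.sub_add_cancel hn]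
  · rw [vecHo_eq_div, hco]

variable {C : RatFunc ℝ} {v : Fin n → ℝ}

theorem IsMinPhaseOutput.vecHo_ne_zero (h : IsMinPhaseOutput A b K v) : vecHo A b K v ≠ 0 := by
  obtain ⟨Nn, Nd, hNn, hNd, -, heq⟩ := h
  rw [heq]
  exact div_ne_zero (RatFunc.algebraMap_ne_zero hNn.1) (RatFunc.algebraMap_ne_zero hNd.1)

theorem filteredInverse_mem_properTransfer (hC : StrictlyProper C) (h : IsMinPhaseOutput A b K v)
    (i : Fin 1) (j : Fin n) : filteredInverse A b K C v i j ∈ properTransfer := by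
  refine properTransfer.mul_mem ?_ (C_mem_properTransfer _)
  by_cases h0 : C = 0
  · rw [h0, zero_mul]
    exact properTransfer.zero_mem
  have hvec := h.vecHo_ne_zero
  have hneg := hC.intDegree_neg h0
  obtain ⟨Nn, Nd, hNn, hNd, hdeg, heq⟩ := h
  rw [mem_properTransfer, RatFunc.intDegree_mul h0 (one_div_ne_zero hvec), one_div,
    RatFunc.intDegree_inv, heq, RatFunc.intDegree_div (RatFunc.algebraMap_ne_zero hNn.1)
    (RatFunc.algebraMap_ne_zero hNd.1), RatFunc.intDegree_polynomial, RatFunc.intDegree_polynomial]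
  omega

theorem stable_filteredInverse (hC : Stable C) (h : IsMinPhaseOutput A b K v)
    (i : Fin 1) (j : Fin n) : Stable (filteredInverse A b K C v i j) := by
  obtain ⟨Nn, Nd, hNn, -, -, heq⟩ := h
  refine (hC.mul ?_).mul (stable_C _)
  rw [heq, one_div_div]
  exact stable_div Nd hNn

theorem sum_filteredInverse_mul_Ho (h : IsMinPhaseOutput A b K v) (i : Fin 1) :
    ∑ j, filteredInverse A b K C v i j * Ho A b K j = C := by
  calc ∑ j, filteredInverse A b K C v i j * Ho A b K j
      = C * (1 / vecHo A b K v) * vecHo A b K v := by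
        simp only [filteredInverse, mul_assoc, ← Finset.mul_sum]
        rfl
    _ = C := by rw [mul_assoc, one_div_mul_cancel h.vecHo_ne_zero, mul_one]

end MinPhase

/-! ### Absolutely continuous functions -/

section AbsolutelyContinuous

theorem absolutelyContinuousOnInterval_of_dist_le {X Y : Type*} [PseudoMetricSpace X]
    [PseudoMetricSpace Y] {f : ℝ → X} {g : ℝ → Y} {a b : ℝ}
    (hf : AbsolutelyContinuousOnInterval f a b)
    (h : ∀ s ∈ Set.uIcc a b, ∀ t ∈ Set.uIcc a b, dist (g s) (g t) ≤ dist (f s) (f t)) :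
    AbsolutelyContinuousOnInterval g a b := by
  rw [absolutelyContinuousOnInterval_iff] at hf ⊢
  intro ε hε
  obtain ⟨δ, hδ, hfδ⟩ := hf ε hε
  refine ⟨δ, hδ, fun E hE hlt => lt_of_le_of_lt ?_ (hfδ E hE hlt)⟩
  exact Finset.sum_le_sum fun i hi => h _ (hE.1 i hi).1 _ (hE.1 i hi).2

theorem absolutelyContinuousOnInterval_norm_sq {E : Type*} [SeminormedAddCommGroup E]
    {f : ℝ → E} {a b : ℝ} (hf : AbsolutelyContinuousOnInterval f a b) :
    AbsolutelyContinuousOnInterval (fun t => ‖f t‖ ^ 2) a b := by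
  have hnorm : AbsolutelyContinuousOnInterval (fun t => ‖f t‖) a b :=
    absolutelyContinuousOnInterval_of_dist_le hf fun s _ t _ =>
      (dist_norm_norm_le _ _).trans_eq (dist_eq_norm (f s) (f t)).symm
  simpa only [sq] using hnorm.fun_mul hnorm

theorem absolutelyContinuousOnInterval_of_hasDerivWithinAt {E : Type*} [NormedAddCommGroup E]
    [NormedSpace ℝ E] {f f' : ℝ → E} {a b : ℝ}
    (hf : ∀ t ∈ Set.uIcc a b, HasDerivWithinAt f (f' t) (Set.uIcc a b) t)
    (hf' : ContinuousOn f' (Set.uIcc a b)) : AbsolutelyContinuousOnInterval f a b := by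
  obtain ⟨M, hM⟩ := isCompact_uIcc.exists_bound_of_continuousOn hf'
  have hlip := (convex_uIcc a b).lipschitzOnWith_of_nnnorm_hasDerivWithin_le (C := M.toNNReal) hf
    fun t ht => NNReal.coe_le_coe.mp ((hM t ht).trans (Real.le_coe_toNNReal M))
  exact hlip.absolutelyContinuousOnInterval

-- The positive part of `f - B` is absolutely continuous with nonpositive derivative.
theorem le_of_hasDerivAt_nonpos_above {f : ℝ → ℝ} {T B : ℝ} (hT : 0 ≤ T)
    (hf : AbsolutelyContinuousOnInterval f 0 T) (h0 : f 0 ≤ B)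
    (hd : ∀ᵐ t, t ∈ Set.Ioo 0 T → ∀ f', HasDerivAt f f' t → B < f t → f' ≤ 0) : f T ≤ B := by
  have hF : AbsolutelyContinuousOnInterval (fun t => max (f t) B) 0 T :=
    absolutelyContinuousOnInterval_of_dist_le hf fun s _ t _ =>
      abs_max_sub_max_le_abs (f s) (f t) B
  have hinteg := hF.integral_deriv_eq_sub
  have hle : ∫ t in (0 : ℝ)..T, deriv (fun t => max (f t) B) t ≤ 0 := by
    rw [intervalIntegral.integral_of_le hT, MeasureTheory.integral_Ioc_eq_integral_Ioo]
    refine MeasureTheory.integral_nonpos_of_ae ?_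
    refine (MeasureTheory.ae_restrict_iff' measurableSet_Ioo).mpr ?_
    filter_upwards [hd] with t ht hmem
    rw [Pi.zero_apply]
    rcases le_or_gt (f t) B with hB | hB
    · have hmin : IsLocalMin (fun t => max (f t) B) t := by
        refine Filter.Eventually.of_forall fun s => ?_
        simp only [max_eq_right hB]
        exact le_max_right _ _
      exact hmin.deriv_eq_zero.le
    · have hc : ContinuousAt f t := by
        refine hf.continuousOn.continuousAt ?_
        rw [Set.uIcc_of_le hT]
        exact Icc_mem_nhds hmem.1 hmem.2
      have heq : (fun t => max (f t) B) =ᶠ[nhds t] f := by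
        filter_upwards [hc.eventually (lt_mem_nhds hB)] with s hs using max_eq_left (le_of_lt hs)
      rw [heq.deriv_eq]
      by_cases hdiff : DifferentiableAt ℝ f t
      · exact ht hmem _ hdiff.hasDerivAt hB
      · exact (deriv_zero_of_not_differentiableAt hdiff).le
  rw [hinteg, max_eq_right h0] at hle
  exact (le_max_left _ _).trans (sub_nonpos.mp hle)

section Integral

variable {E : Type*} [NormedAddCommGroup E] [NormedSpace ℝ E] {f g : ℝ → E} {e : E} {T : ℝ}

theorem absolutelyContinuousOnInterval_integral_add (hT : 0 ≤ T)
    (hf : ∀ t, 0 ≤ t → IntervalIntegrable f MeasureTheory.volume 0 t)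
    (hg : ∀ t, 0 ≤ t → g t = e + ∫ s in (0 : ℝ)..t, f s) :
    AbsolutelyContinuousOnInterval g 0 T := by
  have hN := (hf T hT).norm.absolutelyContinuousOnInterval_intervalIntegral
    (c := 0) Set.left_mem_uIcc
  refine absolutelyContinuousOnInterval_of_dist_le hN fun s hs t ht => ?_
  rw [Set.uIcc_of_le hT] at hs ht
  rw [hg s hs.1, hg t ht.1, dist_add_left, dist_eq_norm, Real.dist_eq,
    intervalIntegral.integral_interval_sub_left (hf s hs.1) (hf t ht.1),
    intervalIntegral.integral_interval_sub_left (hf s hs.1).norm (hf t ht.1).norm]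
  exact intervalIntegral.norm_integral_le_abs_integral_norm

theorem ae_hasDerivAt_integral_add [CompleteSpace E] (hT : 0 ≤ T)
    (hf : IntervalIntegrable f MeasureTheory.volume 0 T)
    (hg : ∀ t, 0 ≤ t → g t = e + ∫ s in (0 : ℝ)..t, f s) :
    ∀ᵐ t, t ∈ Set.Ioo 0 T → HasDerivAt g (f t) t := by
  filter_upwards [hf.ae_hasDerivAt_integral] with t ht htT
  rw [Set.uIcc_of_le hT] at ht
  have hderiv := (ht (Set.Ioo_subset_Icc_self htT) 0 (Set.left_mem_Icc.mpr hT)).const_add e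
  refine hderiv.congr_of_eventuallyEq ?_
  filter_upwards [lt_mem_nhds htT.1] with s hs using hg s hs.le

end Integral

end AbsolutelyContinuous

/-! ### The projection operator -/

section Nearest

variable {E : Type*} [NormedAddCommGroup E] {S : Set E} {w y z : E}

theorem exists_mem_forall_norm_sub_le [ProperSpace E] (hS : IsClosed S) (hne : S.Nonempty)
    (y : E) : ∃ z ∈ S, ∀ w ∈ S, ‖y - z‖ ≤ ‖y - w‖ := by
  obtain ⟨z, hz, h⟩ := hS.exists_infDist_eq_dist hne y
  refine ⟨z, hz, fun w hw => ?_⟩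
  rw [← dist_eq_norm, ← dist_eq_norm, ← h]
  exact Metric.infDist_le_dist_of_mem hw

theorem inner_sub_nonpos_of_forall_norm_sub_le [InnerProductSpace ℝ E] (hS : Convex ℝ S)
    (hz : z ∈ S) (h : ∀ w ∈ S, ‖y - z‖ ≤ ‖y - w‖) (hw : w ∈ S) : inner ℝ (y - z) (w - z) ≤ 0 := by
  have : Nonempty S := ⟨⟨z, hz⟩⟩
  refine (norm_eq_iInf_iff_real_inner_le_zero hS hz).mp (le_antisymm ?_ ?_) w hw
  · exact le_ciInf fun w => h w w.2
  · exact ciInf_le ⟨0, Set.forall_mem_range.mpr fun w => norm_nonneg _⟩ (⟨z, hz⟩ : S)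

end Nearest

section Projection

variable {n : ℕ} {Θ S : Set (EuclideanSpace ℝ (Fin n))} {p y z v w : EuclideanSpace ℝ (Fin n)}

theorem nearest_spec (hS : IsClosed S) (hne : S.Nonempty) (y : EuclideanSpace ℝ (Fin n)) :
    nearest S y ∈ S ∧ ∀ w ∈ S, ‖y - nearest S y‖ ≤ ‖y - w‖ :=
  Classical.epsilon_spec (p := fun z => z ∈ S ∧ ∀ w ∈ S, ‖y - z‖ ≤ ‖y - w‖)
    (exists_mem_forall_norm_sub_le hS hne y)

theorem smul_mem_tangentCone (hv : v ∈ tangentCone Θ p) {a : ℝ} (ha : 0 ≤ a) :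
    a • v ∈ tangentCone Θ p := by
  refine map_mem_closure (continuous_const_smul a) hv ?_
  rintro _ ⟨c, hc, z, hz, rfl⟩
  exact ⟨a * c, mul_nonneg ha hc, z, hz, smul_smul a c _⟩

theorem add_mem_tangentCone (hΘ : Convex ℝ Θ) (hv : v ∈ tangentCone Θ p)
    (hw : w ∈ tangentCone Θ p) : v + w ∈ tangentCone Θ p := by
  refine map_mem_closure₂ continuous_add hv hw ?_
  rintro _ ⟨a, ha, z, hz, rfl⟩ _ ⟨c, hc, z', hz', rfl⟩
  rcases (add_nonneg ha hc).eq_or_lt with h0 | h0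
  · have ha0 : a = 0 := by linarith
    have hc0 : c = 0 := by linarith
    exact ⟨0, le_rfl, z, hz, by simp [ha0, hc0]⟩
  · refine ⟨a + c, h0.le, (a / (a + c)) • z + (c / (a + c)) • z', ?_, ?_⟩
    · exact hΘ hz hz' (by positivity) (by positivity) (by field_simp)
    · rw [smul_sub (a + c), smul_add, smul_smul, smul_smul, mul_div_cancel₀ _ h0.ne',
        mul_div_cancel₀ _ h0.ne']
      module

theorem convex_tangentCone (hΘ : Convex ℝ Θ) (p : EuclideanSpace ℝ (Fin n)) :
    Convex ℝ (tangentCone Θ p) := fun _ hv _ hw _ _ ha hc _ =>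
  add_mem_tangentCone hΘ (smul_mem_tangentCone hv ha) (smul_mem_tangentCone hw hc)

theorem sub_mem_tangentCone (hz : z ∈ Θ) : z - p ∈ tangentCone Θ p :=
  subset_closure ⟨1, zero_le_one, z, hz, (one_smul ℝ _).symm⟩

theorem proj_mem_tangentCone (hne : Θ.Nonempty) (p y : EuclideanSpace ℝ (Fin n)) :
    proj Θ p y ∈ tangentCone Θ p :=
  (nearest_spec isClosed_closure ⟨_, sub_mem_tangentCone hne.some_mem⟩ y).1

theorem inner_sub_proj_nonpos (hΘ : Convex ℝ Θ) (hz : z ∈ Θ) (p y : EuclideanSpace ℝ (Fin n)) :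
    inner ℝ (y - proj Θ p y) (z - p) ≤ 0 := by
  have hspec := nearest_spec (S := tangentCone Θ p) isClosed_closure ⟨_, sub_mem_tangentCone hz⟩ y
  have h := inner_sub_nonpos_of_forall_norm_sub_le (convex_tangentCone hΘ p) hspec.1 hspec.2
    (add_mem_tangentCone hΘ hspec.1 (sub_mem_tangentCone hz))
  rwa [add_sub_cancel_left] at h

theorem inner_sub_nearest_nonpos (hΘ : Convex ℝ Θ) (hz : z ∈ Θ)
    (h : ∀ w ∈ Θ, ‖p - z‖ ≤ ‖p - w‖) (hv : v ∈ tangentCone Θ p) : inner ℝ (p - z) v ≤ 0 := by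
  have hcl : IsClosed {v : EuclideanSpace ℝ (Fin n) | inner ℝ (p - z) v ≤ 0} :=
    isClosed_le (continuous_const.inner continuous_id) continuous_const
  refine closure_minimal ?_ hcl hv
  rintro _ ⟨a, ha, w, hw, rfl⟩
  rw [Set.mem_ofPred_eq, real_inner_smul_right]
  refine mul_nonpos_of_nonneg_of_nonpos ha ?_
  have h1 := inner_sub_nonpos_of_forall_norm_sub_le hΘ hz h hw
  have h2 : w - p = (w - z) - (p - z) := by abel
  rw [h2, inner_sub_right, real_inner_self_eq_norm_sq]
  nlinarith [sq_nonneg ‖p - z‖]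

theorem nonpos_of_hasDerivAt_infDist (hΘc : IsClosed Θ) (hΘ : Convex ℝ Θ)
    {g : ℝ → EuclideanSpace ℝ (Fin n)} {t d : ℝ} (hg : HasDerivAt g v t)
    (hv : v ∈ tangentCone Θ (g t)) (hd : HasDerivAt (fun s => Metric.infDist (g s) Θ) d t)
    (hpos : 0 < Metric.infDist (g t) Θ) : d ≤ 0 := by
  have hne : Θ.Nonempty := Set.nonempty_iff_ne_empty.mpr fun h => by simp [h] at hpos
  obtain ⟨z, hz, hmin⟩ := hΘc.exists_infDist_eq_dist hne (g t)
  have hmax : IsLocalMax (fun s => Metric.infDist (g s) Θ ^ 2 - ‖g s - z‖ ^ 2) t :=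
    Filter.Eventually.of_forall fun s => by
      simp only [hmin, dist_eq_norm, sub_self, sub_nonpos]
      rw [← dist_eq_norm]
      exact pow_le_pow_left₀ Metric.infDist_nonneg (Metric.infDist_le_dist_of_mem hz) 2
  have hzero := hmax.hasDerivAt_eq_zero ((hd.pow 2).sub (hg.sub_const z).norm_sq)
  have hinner : inner ℝ (g t - z) v ≤ 0 := inner_sub_nearest_nonpos hΘ hz
    (fun w hw => by simpa only [← dist_eq_norm, ← hmin] using Metric.infDist_le_dist_of_mem hw) hv
  have hmul : Metric.infDist (g t) Θ * d ≤ 0 := by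
    norm_num at hzero
    linarith
  exact nonpos_of_mul_nonpos_right hmul hpos

theorem mem_of_integral_tangentCone (hΘc : IsClosed Θ) (hΘ : Convex ℝ Θ)
    {f g : ℝ → EuclideanSpace ℝ (Fin n)} (hp : p ∈ Θ)
    (hf : ∀ t, 0 ≤ t → IntervalIntegrable f MeasureTheory.volume 0 t)
    (hg : ∀ t, 0 ≤ t → g t = p + ∫ s in (0 : ℝ)..t, f s)
    (hfg : ∀ t, f t ∈ tangentCone Θ (g t)) {T : ℝ} (hT : 0 ≤ T) : g T ∈ Θ := by
  have hAC : AbsolutelyContinuousOnInterval (fun t => Metric.infDist (g t) Θ) 0 T :=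
    absolutelyContinuousOnInterval_of_dist_le
      (absolutelyContinuousOnInterval_integral_add hT hf hg) fun s _ t _ => by
        simpa using (Metric.lipschitz_infDist_pt Θ).dist_le_mul (g s) (g t)
  have hinit : Metric.infDist (g 0) Θ ≤ 0 := by
    rw [hg 0 le_rfl, intervalIntegral.integral_same, add_zero, Metric.infDist_zero_of_mem hp]
  have hle := le_of_hasDerivAt_nonpos_above hT hAC hinit <| by
    filter_upwards [ae_hasDerivAt_integral_add hT (hf T hT) hg] with t ht htT d hd hpos
    exact nonpos_of_hasDerivAt_infDist hΘc hΘ (ht htT) (hfg t) hd hpos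
  exact (hΘc.mem_iff_infDist_zero ⟨p, hp⟩).mpr (le_antisymm hle Metric.infDist_nonneg)

end Projection

/-! ### The prediction error -/

theorem inner_eq_dotProduct {ι : Type*} [Fintype ι] (p q : EuclideanSpace ℝ ι) :
    inner ℝ p q = p.ofLp ⬝ᵥ q.ofLp := by
  rw [EuclideanSpace.inner_eq_star_dotProduct, star_trivial, dotProduct_comm]

theorem continuousOn_dotProduct {ι X : Type*} [Fintype ι] [TopologicalSpace X] {f g : X → ι → ℝ}
    {s : Set X} (hf : ContinuousOn f s) (hg : ContinuousOn g s) :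
    ContinuousOn (fun t => f t ⬝ᵥ g t) s := by
  have hc : Continuous fun p : (ι → ℝ) × (ι → ℝ) => p.1 ⬝ᵥ p.2 := by fun_prop
  exact hc.comp_continuousOn (hf.prodMk hg)

theorem continuousOn_ofLp {ι X : Type*} [TopologicalSpace X] {f : X → EuclideanSpace ℝ ι}
    {s : Set X} (hf : ContinuousOn f s) : ContinuousOn (fun t => (f t).ofLp) s :=
  (PiLp.continuous_ofLp 2 _).comp_continuousOn hf

section Lyapunov

variable {n : ℕ} {P Q : Matrix (Fin n) (Fin n) ℝ} {Γc : ℝ}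

/-- The Lyapunov function `Γ_c eᵀ P e + ‖θ̂ - θ‖² - ‖θ‖²` of the adaptive law, at the prediction
error `e`, the estimate `p = θ̂` and the parameter `q = θ`. Subtracting `‖θ‖²` removes the
uncontrolled part of the change of `‖θ̂ - θ‖²` due to the motion of `θ`. -/
def lyapunovFn (P : Matrix (Fin n) (Fin n) ℝ) (Γc : ℝ) (e : Fin n → ℝ)
    (p q : EuclideanSpace ℝ (Fin n)) : ℝ :=
  Γc * (e ⬝ᵥ (P *ᵥ e)) + ‖p - q‖ ^ 2 - ‖q‖ ^ 2

theorem lyapunovFn_le {e : Fin n → ℝ} {p q : EuclideanSpace ℝ (Fin n)} {M : ℝ} (hp : ‖p‖ ≤ M)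
    (hq : ‖q‖ ≤ M) : lyapunovFn P Γc e p q ≤ Γc * (e ⬝ᵥ (P *ᵥ e)) + 3 * M ^ 2 := by
  have hM : 0 ≤ M := (norm_nonneg _).trans hp
  have hinner : -(M * M) ≤ inner ℝ p q := (neg_le_neg (mul_le_mul hp hq (norm_nonneg _) hM)).trans
    (neg_le_of_abs_le (abs_real_inner_le_norm p q))
  have hpsq : ‖p‖ ^ 2 ≤ M ^ 2 := pow_le_pow_left₀ (norm_nonneg _) hp 2
  rw [lyapunovFn, norm_sub_sq_real]
  linarith

theorem le_lyapunovFn (e : Fin n → ℝ) (p : EuclideanSpace ℝ (Fin n))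
    {q : EuclideanSpace ℝ (Fin n)} {M : ℝ} (hq : ‖q‖ ≤ M) :
    Γc * (e ⬝ᵥ (P *ᵥ e)) - M ^ 2 ≤ lyapunovFn P Γc e p q := by
  have hqsq : ‖q‖ ^ 2 ≤ M ^ 2 := pow_le_pow_left₀ (norm_nonneg _) hq 2
  rw [lyapunovFn]
  linarith [sq_nonneg ‖p - q‖]

theorem hasDerivAt_lyapunovFn {e : ℝ → Fin n → ℝ} {p q : ℝ → EuclideanSpace ℝ (Fin n)}
    {e' : Fin n → ℝ} {p' q' : EuclideanSpace ℝ (Fin n)} {t : ℝ} (he : HasDerivAt e e' t)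
    (hp : HasDerivAt p p' t) (hq : HasDerivAt q q' t) :
    HasDerivAt (fun t => lyapunovFn P Γc (e t) (p t) (q t))
      (Γc * (e' ⬝ᵥ (P *ᵥ e t) + e t ⬝ᵥ (P *ᵥ e')) +
        2 * inner ℝ (p t - q t) p' - 2 * inner ℝ (p t) q') t := by
  have hV := (hasDerivWithinAt_dotProduct he.hasDerivWithinAt
    (hasDerivWithinAt_mulVec P he.hasDerivWithinAt)).hasDerivAt Filter.univ_mem
  refine (((hV.const_mul Γc).add (hp.sub hq).norm_sq).sub hq.norm_sq).congr_deriv ?_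
  rw [Pi.sub_apply, inner_sub_right, inner_sub_left _ _ q']
  ring

theorem absolutelyContinuousOnInterval_lyapunovFn {e e' : ℝ → Fin n → ℝ}
    {p q : ℝ → EuclideanSpace ℝ (Fin n)} {a b : ℝ}
    (he : ∀ t ∈ Set.uIcc a b, HasDerivWithinAt e (e' t) (Set.uIcc a b) t)
    (he' : ContinuousOn e' (Set.uIcc a b)) (hp : AbsolutelyContinuousOnInterval p a b)
    (hq : AbsolutelyContinuousOnInterval q a b) :
    AbsolutelyContinuousOnInterval (fun t => lyapunovFn P Γc (e t) (p t) (q t)) a b := by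
  have hec : ContinuousOn e (Set.uIcc a b) := fun t ht => (he t ht).continuousWithinAt
  have hmul : Continuous fun v : Fin n → ℝ => P *ᵥ v := by fun_prop
  have hV : AbsolutelyContinuousOnInterval (fun t => e t ⬝ᵥ (P *ᵥ e t)) a b :=
    absolutelyContinuousOnInterval_of_hasDerivWithinAt
      (fun t ht => hasDerivWithinAt_dotProduct (he t ht) (hasDerivWithinAt_mulVec P (he t ht)))
      ((continuousOn_dotProduct he' (hmul.comp_continuousOn hec)).add
        (continuousOn_dotProduct hec (hmul.comp_continuousOn he')))
  exact ((hV.const_mul Γc).fun_add (absolutelyContinuousOnInterval_norm_sq (hp.fun_sub hq))).fun_sub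
    (absolutelyContinuousOnInterval_norm_sq hq)

theorem lyapunov_form_deriv {F : Matrix (Fin n) (Fin n) ℝ} (hPT : Pᵀ = P)
    (hP : Fᵀ * P + P * F = -Q) (b e : Fin n → ℝ) (w : ℝ) :
    (F *ᵥ e + w • b) ⬝ᵥ (P *ᵥ e) + e ⬝ᵥ (P *ᵥ (F *ᵥ e + w • b)) =
      -(e ⬝ᵥ (Q *ᵥ e)) + 2 * w * (e ⬝ᵥ (P *ᵥ b)) := by
  have hinput : b ⬝ᵥ (P *ᵥ e) = e ⬝ᵥ (P *ᵥ b) := by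
    rw [Matrix.dotProduct_mulVec, ← Matrix.mulVec_transpose, hPT, dotProduct_comm]
  have hfree : (F *ᵥ e) ⬝ᵥ (P *ᵥ e) + e ⬝ᵥ (P *ᵥ (F *ᵥ e)) = -(e ⬝ᵥ (Q *ᵥ e)) := by
    rw [← dotProduct_neg, ← Matrix.neg_mulVec, ← hP, Matrix.add_mulVec, dotProduct_add,
      ← Matrix.mulVec_mulVec, ← Matrix.mulVec_mulVec, Matrix.dotProduct_mulVec _ Fᵀ,
      Matrix.vecMul_transpose]
  rw [← hfree, add_dotProduct, smul_dotProduct, Matrix.mulVec_add, dotProduct_add,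
    Matrix.mulVec_smul, dotProduct_smul, hinput, smul_eq_mul]
  ring

variable {Θ : Set (EuclideanSpace ℝ (Fin n))} {p q : EuclideanSpace ℝ (Fin n)}

theorem adaptRate_mem_tangentCone (hne : Θ.Nonempty) (hΓc : 0 ≤ Γc) (b : Fin n → ℝ)
    (p : EuclideanSpace ℝ (Fin n)) (x xhat : Fin n → ℝ) :
    adaptRate Θ P b Γc p x xhat ∈ tangentCone Θ p :=
  smul_mem_tangentCone (proj_mem_tangentCone hne _ _) hΓc

theorem inner_sub_adaptRate_le (hΘ : Convex ℝ Θ) (hq : q ∈ Θ) (hΓc : 0 ≤ Γc)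
    (p : EuclideanSpace ℝ (Fin n)) (b x xhat : Fin n → ℝ) :
    inner ℝ (p - q) (adaptRate Θ P b Γc p x xhat) ≤
      Γc * (((xhat - x) ⬝ᵥ (P *ᵥ b)) * ((p - q).ofLp ⬝ᵥ x)) := by
  have hproj := inner_sub_proj_nonpos hΘ hq p (WithLp.toLp 2 (((xhat - x) ⬝ᵥ (P *ᵥ b)) • x))
  rw [← neg_sub p q, inner_neg_right, real_inner_comm, inner_sub_right,
    inner_eq_dotProduct _ (WithLp.toLp 2 _), dotProduct_smul, smul_eq_mul] at hproj
  rw [adaptRate, real_inner_smul_right]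
  exact mul_le_mul_of_nonneg_left (by linarith) hΓc

-- The term `2 Γ_c (θ̂ - θ)ᵀ x (eᵀ P b)` coming from `e` is cancelled by the adaptive law.
theorem lyapunovFn_rate_le {F : Matrix (Fin n) (Fin n) ℝ} (hPT : Pᵀ = P)
    (hP : Fᵀ * P + P * F = -Q) (hΘ : Convex ℝ Θ) (hq : q ∈ Θ) (hΓc : 0 ≤ Γc) {M d : ℝ}
    (hp : ‖p‖ ≤ M) {q' : EuclideanSpace ℝ (Fin n)} (hq' : ‖q'‖ ≤ d) (b x xhat : Fin n → ℝ)
    {e' : Fin n → ℝ} (he' : e' = F *ᵥ (xhat - x) + (-((p - q).ofLp ⬝ᵥ x)) • b) :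
    Γc * (e' ⬝ᵥ (P *ᵥ (xhat - x)) + (xhat - x) ⬝ᵥ (P *ᵥ e')) +
        2 * inner ℝ (p - q) (adaptRate Θ P b Γc p x xhat) - 2 * inner ℝ p q' ≤
      2 * (M * d) - Γc * ((xhat - x) ⬝ᵥ (Q *ᵥ (xhat - x))) := by
  have hadapt := inner_sub_adaptRate_le (P := P) hΘ hq hΓc p b x xhat
  have hdrift : -(M * d) ≤ inner ℝ p q' :=
    (neg_le_neg (mul_le_mul hp hq' (norm_nonneg _) ((norm_nonneg _).trans hp))).trans
      (neg_le_of_abs_le (abs_real_inner_le_norm p q'))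
  rw [he', lyapunov_form_deriv hPT hP]
  linarith

end Lyapunov

section Adaptive

theorem Am_mulVec {n : ℕ} (A : Matrix (Fin n) (Fin n) ℝ) (b K v : Fin n → ℝ) :
    Am A b K *ᵥ v = A *ᵥ v - (K ⬝ᵥ v) • b := by
  rw [Am, Matrix.sub_mulVec, Matrix.vecMulVec_mulVec, op_smul_eq_smul]

variable {n : ℕ} {A : Matrix (Fin n) (Fin n) ℝ} {b c K : Fin n → ℝ} {C : RatFunc ℝ}
  {P Q : Matrix (Fin n) (Fin n) ℝ} {Γc : ℝ} {Θ : Set (EuclideanSpace ℝ (Fin n))}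
  {r : ℝ → ℝ} {x₀ : Fin n → ℝ} {θhat₀ : EuclideanSpace ℝ (Fin n)}
  {θ : ℝ → EuclideanSpace ℝ (Fin n)} {dθ : ℝ≥0} {x : ℝ → Fin n → ℝ} {u : ℝ → ℝ}
  {xhat : ℝ → Fin n → ℝ} {θhat : ℝ → EuclideanSpace ℝ (Fin n)}

theorem IsPlant.continuousOn (h : IsPlant A b x₀ θ x u) : ContinuousOn x (Set.Ici 0) :=
  fun t ht => (h.ode t ht).continuousWithinAt

namespace IsAdaptiveLoop

theorem continuousOn_xhat (h : IsAdaptiveLoop A b c K C Θ P Γc r x₀ θhat₀ θ x u xhat θhat) :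
    ContinuousOn xhat (Set.Ici 0) :=
  fun t ht => (h.predictor t ht).continuousWithinAt

theorem absolutelyContinuousOnInterval_θhat
    (h : IsAdaptiveLoop A b c K C Θ P Γc r x₀ θhat₀ θ x u xhat θhat) {T : ℝ} (hT : 0 ≤ T) :
    AbsolutelyContinuousOnInterval θhat 0 T :=
  absolutelyContinuousOnInterval_integral_add hT h.adapt_integrable h.adapt

theorem continuousOn_θhat (h : IsAdaptiveLoop A b c K C Θ P Γc r x₀ θhat₀ θ x u xhat θhat) :
    ContinuousOn θhat (Set.Ici 0) := by
  intro t ht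
  have hle : (0 : ℝ) ≤ t + 1 := add_nonneg ht zero_le_one
  have hc := (h.absolutelyContinuousOnInterval_θhat hle).continuousOn
  rw [Set.uIcc_of_le hle] at hc
  refine (hc t ⟨ht, (lt_add_one t).le⟩).mono_of_mem_nhdsWithin ?_
  filter_upwards [self_mem_nhdsWithin, mem_nhdsWithin_of_mem_nhds (gt_mem_nhds (lt_add_one t))]
    with s hs hs' using ⟨hs, le_of_lt hs'⟩

theorem θhat_mem (h : IsAdaptiveLoop A b c K C Θ P Γc r x₀ θhat₀ θ x u xhat θhat)
    (hΓc : 0 ≤ Γc) (hΘc : IsClosed Θ) (hΘ : Convex ℝ Θ) (h0 : θhat₀ ∈ Θ) {t : ℝ} (ht : 0 ≤ t) :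
    θhat t ∈ Θ :=
  mem_of_integral_tangentCone hΘc hΘ h0 h.adapt_integrable h.adapt
    (fun _ => adaptRate_mem_tangentCone ⟨_, h0⟩ hΓc _ _ _ _) ht

theorem hasDerivWithinAt_sub (h : IsAdaptiveLoop A b c K C Θ P Γc r x₀ θhat₀ θ x u xhat θhat)
    {t : ℝ} (ht : 0 ≤ t) :
    HasDerivWithinAt (fun t => xhat t - x t) (Am A b K *ᵥ (xhat t - x t) +
      (-((θhat t - θ t).ofLp ⬝ᵥ x t)) • b) (Set.Ici 0) t := by
  refine ((h.predictor t ht).sub (h.plant.ode t ht)).congr_deriv ?_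
  rw [Matrix.mulVec_sub, Am_mulVec A b K (x t), WithLp.ofLp_sub, sub_dotProduct]
  module

theorem absolutelyContinuousOnInterval_lyapunovFn
    (h : IsAdaptiveLoop A b c K C Θ P Γc r x₀ θhat₀ θ x u xhat θhat)
    (hθ : LipschitzOnWith dθ θ (Set.Ici 0)) {T : ℝ} (hT : 0 ≤ T) :
    AbsolutelyContinuousOnInterval
      (fun t => lyapunovFn P Γc (xhat t - x t) (θhat t) (θ t)) 0 T := by
  have hsub : Set.uIcc 0 T ⊆ Set.Ici (0 : ℝ) := by
    rw [Set.uIcc_of_le hT]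
    exact Set.Icc_subset_Ici_self
  have hmul : Continuous fun v : Fin n → ℝ => Am A b K *ᵥ v := by fun_prop
  have hrate : ContinuousOn (fun t => Am A b K *ᵥ (xhat t - x t) +
      (-((θhat t - θ t).ofLp ⬝ᵥ x t)) • b) (Set.Ici 0) :=
    (hmul.comp_continuousOn (h.continuousOn_xhat.sub h.plant.continuousOn)).add
      ((continuousOn_dotProduct (continuousOn_ofLp (h.continuousOn_θhat.sub hθ.continuousOn))
        h.plant.continuousOn).neg.smul continuousOn_const)
  exact L1Adaptive.absolutelyContinuousOnInterval_lyapunovFn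
    (fun t ht => (h.hasDerivWithinAt_sub (hsub ht)).mono hsub) (hrate.mono hsub)
    (h.absolutelyContinuousOnInterval_θhat hT) (hθ.mono hsub).absolutelyContinuousOnInterval

theorem ae_hasDerivAt_lyapunovFn_le
    (h : IsAdaptiveLoop A b c K C Θ P Γc r x₀ θhat₀ θ x u xhat θhat) (hΓc : 0 ≤ Γc)
    (hΘc : IsClosed Θ) (hΘ : Convex ℝ Θ) (h0 : θhat₀ ∈ Θ) (hPT : Pᵀ = P)
    (hP : (Am A b K)ᵀ * P + P * Am A b K = -Q) {M : ℝ} (hM : ∀ p ∈ Θ, ‖p‖ ≤ M)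
    (hθmem : ∀ t, 0 ≤ t → θ t ∈ Θ) (hθ : LipschitzOnWith dθ θ (Set.Ici 0)) {T : ℝ} (hT : 0 ≤ T) :
    ∀ᵐ t, t ∈ Set.Ioo 0 T → ∀ d,
      HasDerivAt (fun t => lyapunovFn P Γc (xhat t - x t) (θhat t) (θ t)) d t →
        d ≤ 2 * (M * dθ) - Γc * ((xhat t - x t) ⬝ᵥ (Q *ᵥ (xhat t - x t))) := by
  filter_upwards [ae_hasDerivAt_integral_add hT (h.adapt_integrable T hT) h.adapt,
    hθ.ae_differentiableWithinAt_of_mem_real] with t hθhat hdiff htT d hd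
  have ht : 0 ≤ t := htT.1.le
  have hIci : Set.Ici (0 : ℝ) ∈ nhds t := Ici_mem_nhds htT.1
  have hderiv := hasDerivAt_lyapunovFn (P := P) (Γc := Γc)
    ((h.hasDerivWithinAt_sub ht).hasDerivAt hIci) (hθhat htT)
    ((hdiff ht).differentiableAt hIci).hasDerivAt
  rw [hd.unique hderiv]
  exact lyapunovFn_rate_le hPT hP hΘ (hθmem t ht) hΓc (hM _ (h.θhat_mem hΓc hΘc hΘ h0 ht))
    (norm_deriv_le_of_lipschitzOn hIci hθ) b (x t) (xhat t) rfl

theorem lyapunov_form_le (h : IsAdaptiveLoop A b c K C Θ P Γc r x₀ θhat₀ θ x u xhat θhat)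
    (hΓc : 0 ≤ Γc) (hΘc : IsClosed Θ) (hΘ : Convex ℝ Θ) (h0 : θhat₀ ∈ Θ) (hPT : Pᵀ = P)
    (hP : (Am A b K)ᵀ * P + P * Am A b K = -Q) {μ M : ℝ} (hμ : 0 < μ)
    (hμPQ : ∀ e : Fin n → ℝ, μ * (e ⬝ᵥ (P *ᵥ e)) ≤ e ⬝ᵥ (Q *ᵥ e))
    (hM : ∀ p ∈ Θ, ‖p‖ ≤ M) (hθmem : ∀ t, 0 ≤ t → θ t ∈ Θ)
    (hθ : LipschitzOnWith dθ θ (Set.Ici 0)) {T : ℝ} (hT : 0 ≤ T) :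
    Γc * ((xhat T - x T) ⬝ᵥ (P *ᵥ (xhat T - x T))) ≤ 4 * M ^ 2 + 2 * M * dθ / μ := by
  have hM0 : 0 ≤ M := (norm_nonneg _).trans (hM _ h0)
  have hupper : ∀ t, 0 ≤ t → lyapunovFn P Γc (xhat t - x t) (θhat t) (θ t) ≤
      Γc * ((xhat t - x t) ⬝ᵥ (P *ᵥ (xhat t - x t))) + 3 * M ^ 2 := fun t ht =>
    lyapunovFn_le (hM _ (h.θhat_mem hΓc hΘc hΘ h0 ht)) (hM _ (hθmem t ht))
  have hinit : lyapunovFn P Γc (xhat 0 - x 0) (θhat 0) (θ 0) ≤ 3 * M ^ 2 + 2 * M * dθ / μ := by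
    have hdrift : 0 ≤ 2 * M * dθ / μ := by positivity
    have hstart := hupper 0 le_rfl
    rw [h.predictor_init, h.plant.init, sub_self, zero_dotProduct, mul_zero] at hstart
    rw [h.predictor_init, h.plant.init, sub_self]
    linarith
  have hbarrier := le_of_hasDerivAt_nonpos_above hT
    (h.absolutelyContinuousOnInterval_lyapunovFn hθ hT) hinit <| by
    filter_upwards [h.ae_hasDerivAt_lyapunovFn_le hΓc hΘc hΘ h0 hPT hP hM hθmem hθ hT]
      with t hle htT d hd hgt
    have hlow : 2 * M * dθ / μ ≤ Γc * ((xhat t - x t) ⬝ᵥ (P *ᵥ (xhat t - x t))) := by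
      linarith [hupper t htT.1.le]
    have hdecay := mul_le_mul_of_nonneg_left (hμPQ (xhat t - x t)) hΓc
    linarith [hle htT d hd, (div_le_iff₀ hμ).mp hlow]
  linarith [le_lyapunovFn (P := P) (Γc := Γc) (xhat T - x T) (θhat T) (hM _ (hθmem T hT))]

end IsAdaptiveLoop

theorem exists_isMaxOn_norm_thetaM_eq (hΘ : IsCompact Θ) (hne : Θ.Nonempty)
    (P Q : Matrix (Fin n) (Fin n) ℝ) (d : ℝ) : ∃ p ∈ Θ, IsMaxOn norm Θ p ∧
      thetaM Θ P Q d = 4 * ‖p‖ ^ 2 + 2 * (d * lamMax P / lamMin Q) * ‖p‖ := by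
  obtain ⟨p, hp, hmax⟩ := hΘ.exists_isMaxOn hne continuous_norm.continuousOn
  have hsum : ∀ q : EuclideanSpace ℝ (Fin n), ∑ i, 4 * q i ^ 2 = 4 * ‖q‖ ^ 2 := fun q => by
    rw [EuclideanSpace.real_norm_sq_eq, Finset.mul_sum]
  have hsq : IsGreatest ((fun p : EuclideanSpace ℝ (Fin n) => ∑ i, 4 * p i ^ 2) '' Θ)
      (4 * ‖p‖ ^ 2) := by
    refine ⟨⟨p, hp, hsum p⟩, Set.forall_mem_image.mpr fun q hq => ?_⟩
    rw [hsum]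
    gcongr
    exact hmax hq
  have hnorm : IsGreatest ((fun p : EuclideanSpace ℝ (Fin n) => ‖p‖) '' Θ) ‖p‖ :=
    ⟨⟨p, hp, rfl⟩, Set.forall_mem_image.mpr fun q hq => hmax hq⟩
  refine ⟨p, hp, hmax, ?_⟩
  rw [thetaM, hsq.csSup_eq, hnorm.csSup_eq]

theorem norm_sq_le_dotProduct_self {ι : Type*} [Fintype ι] (e : ι → ℝ) : ‖e‖ ^ 2 ≤ e ⬝ᵥ e := by
  have hnonneg : 0 ≤ e ⬝ᵥ e := Finset.sum_nonneg fun i _ => mul_self_nonneg (e i)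
  refine (Real.le_sqrt (norm_nonneg e) hnonneg).mp
    ((pi_norm_le_iff_of_nonneg (Real.sqrt_nonneg _)).mpr fun i => Real.abs_le_sqrt ?_)
  rw [sq]
  exact Finset.single_le_sum (f := fun i => e i * e i) (fun i _ => mul_self_nonneg _)
    (Finset.mem_univ i)

theorem lamMin_mul_norm_sq_le {M : Matrix (Fin n) (Fin n) ℝ} (hn : 0 < n) (hM : M.PosDef)
    (e : Fin n → ℝ) : lamMin M * ‖e‖ ^ 2 ≤ e ⬝ᵥ (M *ᵥ e) :=
  (mul_le_mul_of_nonneg_left (norm_sq_le_dotProduct_self e) (lamMin_pos hn hM).le).trans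
    (lamMin_mul_le hM.isHermitian e)

theorem lamMin_div_lamMax_mul_le (hn : 0 < n) (hPpos : P.PosDef) (hQ : Q.PosDef)
    (e : Fin n → ℝ) : lamMin Q / lamMax P * (e ⬝ᵥ (P *ᵥ e)) ≤ e ⬝ᵥ (Q *ᵥ e) := by
  refine le_trans ?_ (lamMin_mul_le hQ.isHermitian e)
  rw [div_mul_eq_mul_div, div_le_iff₀ (lamMax_pos hn hPpos), mul_assoc, mul_comm (e ⬝ᵥ e)]
  exact mul_le_mul_of_nonneg_left (le_lamMax_mul hPpos.isHermitian e) (lamMin_pos hn hQ).le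

theorem IsAdaptiveLoop.norm_sub_le (hn : 0 < n)
    (h : IsAdaptiveLoop A b c K C Θ P Γc r x₀ θhat₀ θ x u xhat θhat) (hΓc : 0 < Γc)
    (hK : IsHurwitz (Am A b K)) (hQ : Q.PosDef)
    (hP : (Am A b K)ᵀ * P + P * Am A b K = -Q)
    (hΘc : IsCompact Θ) (hΘ : Convex ℝ Θ) (h0 : θhat₀ ∈ Θ) (hθmem : ∀ t, 0 ≤ t → θ t ∈ Θ)
    (hθ : LipschitzOnWith dθ θ (Set.Ici 0)) {t : ℝ} (ht : 0 ≤ t) :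
    ‖xhat t - x t‖ ≤ Real.sqrt (thetaM Θ P Q dθ / (lamMin P * Γc)) := by
  have hPpos := lyapunov_posDef hK hQ hP
  have hPT : Pᵀ = P := by simpa using hPpos.isHermitian.eq
  obtain ⟨p, -, hmax, hθm⟩ := exists_isMaxOn_norm_thetaM_eq hΘc ⟨_, h0⟩ P Q dθ
  have hform := h.lyapunov_form_le hΓc.le hΘc.isClosed hΘ h0 hPT hP
    (div_pos (lamMin_pos hn hQ) (lamMax_pos hn hPpos)) (lamMin_div_lamMax_mul_le hn hPpos hQ)
    (fun q hq => hmax hq) hθmem hθ ht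
  have hbound : 4 * ‖p‖ ^ 2 + 2 * ‖p‖ * dθ / (lamMin Q / lamMax P) = thetaM Θ P Q dθ := by
    rw [hθm]
    field_simp
  refine Real.le_sqrt_of_sq_le ?_
  rw [le_div_iff₀ (mul_pos (lamMin_pos hn hPpos) hΓc)]
  calc ‖xhat t - x t‖ ^ 2 * (lamMin P * Γc)
      = Γc * (lamMin P * ‖xhat t - x t‖ ^ 2) := by ring
    _ ≤ Γc * ((xhat t - x t) ⬝ᵥ (P *ᵥ (xhat t - x t))) :=
        mul_le_mul_of_nonneg_left (lamMin_mul_norm_sq_le hn hPpos _) hΓc.le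
    _ ≤ thetaM Θ P Q dθ := hform.trans_eq hbound

end Adaptive

/-! ### The error of the closed loop -/

section Norms

variable {m n : ℕ}

theorem l1Gain_neg {G : RatFunc ℝ} (hG : G ∈ properTransfer) : l1Gain (-G) = l1Gain G := by
  have hexp : expansion (-G) = -expansion G := by
    rw [← neg_one_mul G, ← neg_one_mul (expansion G), ← map_one RatFunc.C, ← map_neg,
      expansion_mul (C_mem_properTransfer _) hG, expansion_C, map_neg, map_one]
  have himpulse : ∀ t, impulse (-G) t = -impulse G t := fun t => by
    simp only [impulse, hexp, map_neg, neg_mul, neg_div, tsum_neg]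
  simp only [l1Gain, feedthrough, himpulse, hexp, map_neg, abs_neg]

theorem sum_l1Gain_le_l1GainMat (H : Matrix (Fin n) (Fin m) (RatFunc ℝ)) (i : Fin n) :
    ∑ j, l1Gain (H i j) ≤ l1GainMat H :=
  le_ciSup (f := fun i => ∑ j, l1Gain (H i j)) (Set.finite_range _).bddAbove i

theorem l1GainMat_nonneg (H : Matrix (Fin n) (Fin m) (RatFunc ℝ)) : 0 ≤ l1GainMat H :=
  Real.iSup_nonneg fun _ => Finset.sum_nonneg fun _ _ => l1Gain_nonneg _

theorem abs_sum_response_le {H : Matrix (Fin n) (Fin m) (RatFunc ℝ)} {i : Fin n}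
    (hH : ∀ j, H i j ∈ properTransfer) (hs : ∀ j, Stable (H i j)) {v : ℝ → Fin m → ℝ} {t M : ℝ}
    (ht : 0 ≤ t) (hv : ∀ s ∈ Set.Icc 0 t, ‖v s‖ ≤ M) :
    |∑ j, response (H i j) (fun s => v s j) t| ≤ l1GainMat H * M := by
  have hM : 0 ≤ M := (norm_nonneg _).trans (hv t ⟨ht, le_rfl⟩)
  calc |∑ j, response (H i j) (fun s => v s j) t|
      ≤ ∑ j, |response (H i j) (fun s => v s j) t| := Finset.abs_sum_le_sum_abs _ _
    _ ≤ ∑ j, l1Gain (H i j) * M := Finset.sum_le_sum fun j _ =>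
        abs_response_le (hH j) (hs j) ht fun s hs => (norm_le_pi_norm (v s) j).trans (hv s hs)
    _ ≤ l1GainMat H * M := by
        rw [← Finset.sum_mul]
        exact mul_le_mul_of_nonneg_right (sum_l1Gain_le_l1GainMat H i) hM

theorem linftyNorm_le {E : Type*} [NormedAddCommGroup E] {ξ : ℝ → E} {γ : ℝ}
    (h : ∀ t, 0 ≤ t → ‖ξ t‖ ≤ γ) : linftyNorm ξ ≤ ENNReal.ofReal γ :=
  iSup₂_le fun t ht => (ofReal_norm (ξ t)).symm.trans_le (ENNReal.ofReal_le_ofReal (h t ht))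

theorem abs_dotProduct_le_sum_abs_mul_norm {ι : Type*} [Fintype ι] (v w : ι → ℝ) :
    |v ⬝ᵥ w| ≤ (∑ i, |v i|) * ‖w‖ := by
  calc |v ⬝ᵥ w| ≤ ∑ i, |v i * w i| := Finset.abs_sum_le_sum_abs _ _
    _ ≤ ∑ i, |v i| * ‖w‖ := Finset.sum_le_sum fun i _ => by
        rw [abs_mul]
        exact mul_le_mul_of_nonneg_left (norm_le_pi_norm w i) (abs_nonneg _)
    _ = (∑ i, |v i|) * ‖w‖ := by rw [Finset.sum_mul]

variable {Θ : Set (EuclideanSpace ℝ (Fin n))}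

theorem thetaMax_nonneg (Θ : Set (EuclideanSpace ℝ (Fin n))) : 0 ≤ thetaMax Θ :=
  Real.sSup_nonneg <| Set.forall_mem_image.mpr fun _ _ => Finset.sum_nonneg fun _ _ => abs_nonneg _

theorem abs_dotProduct_le_thetaMax_mul_norm (hΘ : IsCompact Θ) {p : EuclideanSpace ℝ (Fin n)}
    (hp : p ∈ Θ) (w : Fin n → ℝ) : |p.ofLp ⬝ᵥ w| ≤ thetaMax Θ * ‖w‖ := by
  have hc : Continuous fun p : EuclideanSpace ℝ (Fin n) => ∑ i, |p i| := by fun_prop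
  have hle : ∑ i, |p i| ≤ thetaMax Θ := le_csSup (hΘ.image hc).bddAbove ⟨p, hp, rfl⟩
  exact (abs_dotProduct_le_sum_abs_mul_norm _ w).trans
    (mul_le_mul_of_nonneg_right hle (norm_nonneg w))

variable {A : Matrix (Fin n) (Fin n) ℝ} {b K : Fin n → ℝ} {C : RatFunc ℝ}

theorem Gbar_mem_properTransfer (hC : C ∈ properTransfer) (i : Fin n) (j : Fin 1) :
    Gbar A b K C i j ∈ properTransfer :=
  mul_mem (stateTransfer_mem_properTransfer (Am A b K) b i) (sub_mem hC (one_mem _))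

theorem stable_Gbar (hK : IsHurwitz (Am A b K)) (hC : Stable C) (i : Fin n) (j : Fin 1) :
    Stable (Gbar A b K C i j) := by
  have hsub : Stable (C - 1) := by
    simpa [sub_eq_add_neg] using hC.add (stable_C (-1))
  exact (stable_stateTransfer hK b i).mul hsub

theorem l1GainMat_HoOneSub (hC : C ∈ properTransfer) :
    l1GainMat (HoOneSub A b K C) = l1GainMat (Gbar A b K C) := by
  have hneg : ∀ i j, HoOneSub A b K C i j = -Gbar A b K C i j := fun i j => by
    rw [HoOneSub, Gbar, ← mul_neg, neg_sub]
  simp only [l1GainMat, hneg, l1Gain_neg (Gbar_mem_properTransfer hC _ _)]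

end Norms

section Loops

variable {T : ℝ≥0}

theorem exists_signal_eq {f : ℝ → ℝ} (hf : ContinuousOn f (Set.Ici 0)) :
    ∃ v : Signal T, ∀ t, v t = f t :=
  ⟨⟨_, (hf.mono Set.Icc_subset_Ici_self).domRestrict⟩, fun _ => rfl⟩

variable {n : ℕ} {A : Matrix (Fin n) (Fin n) ℝ} {b c K : Fin n → ℝ} {C : RatFunc ℝ}
  {P : Matrix (Fin n) (Fin n) ℝ} {Γc : ℝ} {Θ : Set (EuclideanSpace ℝ (Fin n))}
  {r : ℝ → ℝ} {x₀ : Fin n → ℝ} {θhat₀ : EuclideanSpace ℝ (Fin n)}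
  {θ : ℝ → EuclideanSpace ℝ (Fin n)} {x : ℝ → Fin n → ℝ} {u : ℝ → ℝ}
  {xhat : ℝ → Fin n → ℝ} {θhat : ℝ → EuclideanSpace ℝ (Fin n)}
  {xref : ℝ → Fin n → ℝ} {uref : ℝ → ℝ} {S W : Signal T}

theorem stateSignal_transferOp_sub (hC : C ∈ properTransfer) (i : Fin n) :
    stateSignal (Am A b K) b (transferOp T ⟨C, hC⟩ (S - W) - S) i =
      transferOp T ⟨Gbar A b K C i 0, Gbar_mem_properTransfer hC i 0⟩ S -
        transferOp T ⟨C, hC⟩ (stateSignal (Am A b K) b W i) := by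
  set H : properTransfer :=
    ⟨stateTransfer (Am A b K) b i, stateTransfer_mem_properTransfer (Am A b K) b i⟩
  have hG : (⟨Gbar A b K C i 0, Gbar_mem_properTransfer hC i 0⟩ : properTransfer) =
      H * ⟨C, hC⟩ - H := Subtype.ext (mul_sub_one _ _)
  have hcomm : transferOp T ⟨C, hC⟩ (transferOp T H W) =
      transferOp T H (transferOp T ⟨C, hC⟩ W) := by
    rw [← mul_apply_eq_comp, ← mul_apply_eq_comp, ← map_mul, ← map_mul, mul_comm]
  change transferOp T H _ = _ - transferOp T ⟨C, hC⟩ (transferOp T H W)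
  rw [hG, hcomm, map_sub (transferOp T), map_mul, sub_apply, mul_apply_eq_comp, map_sub, map_sub,
    map_sub]
  abel

theorem transferOp_eq_sum_filteredInverse (hC : StrictlyProper C) {v : Fin n → ℝ}
    (hv : IsMinPhaseOutput A b K v) :
    transferOp T ⟨C, hC.mem_properTransfer⟩ W = ∑ j, transferOp T
      ⟨filteredInverse A b K C v 0 j, filteredInverse_mem_properTransfer hC hv 0 j⟩
        (stateSignal (Am A b K) b W j) := by
  have hsum : (⟨C, hC.mem_properTransfer⟩ : properTransfer) =
      ∑ j, ⟨filteredInverse A b K C v 0 j, filteredInverse_mem_properTransfer hC hv 0 j⟩ *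
        ⟨stateTransfer (Am A b K) b j, stateTransfer_mem_properTransfer (Am A b K) b j⟩ := by
    ext1
    push_cast
    exact (sum_filteredInverse_mul_Ho hv 0).symm
  rw [hsum, map_sum, FunLike.coe_sum, Finset.sum_apply]
  simp only [map_mul, mul_apply_eq_comp, stateSignal]

theorem IsPlant.sub_eq_stateSignal (h : IsPlant A b x₀ θ x u) (h' : IsPlant A b x₀ θ xref uref)
    {D : Signal T} (hS : ∀ t, S t = (θ t).ofLp ⬝ᵥ (x t - xref t))
    (hD : ∀ t, D t = u t - uref t + K ⬝ᵥ (x t - xref t)) (i : Fin n) (t : Set.Icc (0 : ℝ) T) :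
    x t i - xref t i = stateSignal (Am A b K) b (D - S) i t := by
  refine (eq_stateSignal_of_hasDerivWithinAt (y := fun t => x t - xref t)
    (w := fun t => u t - uref t + K ⬝ᵥ (x t - xref t) - (θ t).ofLp ⬝ᵥ (x t - xref t))
    (by simp only [h.init, h'.init, sub_self]) (fun t ht => ?_)
    (fun t => by rw [ContinuousMap.sub_apply, hD, hS]) i t).symm
  refine ((h.ode t ht).sub (h'.ode t ht)).congr_deriv ?_
  rw [Am_mulVec, Matrix.mulVec_sub, dotProduct_sub (θ t).ofLp]
  module

namespace IsAdaptiveLoop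

theorem stateSignal_eq (h : IsAdaptiveLoop A b c K C Θ P Γc r x₀ θhat₀ θ x u xhat θhat)
    (hW : ∀ t, W t = -((θhat t - θ t).ofLp ⬝ᵥ x t)) (i : Fin n) (t : Set.Icc (0 : ℝ) T) :
    stateSignal (Am A b K) b W i t = xhat t i - x t i :=
  eq_stateSignal_of_hasDerivWithinAt (y := fun t => xhat t - x t)
    (by simp only [h.predictor_init, h.plant.init, sub_self])
    (fun _ => h.hasDerivWithinAt_sub) hW i t

theorem control_sub_eq_transferOp
    (h : IsAdaptiveLoop A b c K C Θ P Γc r x₀ θhat₀ θ x u xhat θhat)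
    (href : IsReferenceLoop A b c K C r x₀ θ xref uref) (hC : C ∈ properTransfer)
    (hr : ContinuousOn r (Set.Ici 0)) (hθ : ContinuousOn θ (Set.Ici 0))
    (hS : ∀ t, S t = (θ t).ofLp ⬝ᵥ (x t - xref t))
    (hW : ∀ t, W t = -((θhat t - θ t).ofLp ⬝ᵥ x t)) (t : Set.Icc (0 : ℝ) T) :
    u t - uref t + K ⬝ᵥ (x t - xref t) = transferOp T ⟨C, hC⟩ (S - W) t := by
  have hkr := hr.const_mul (kg A b c K)
  obtain ⟨v, hv⟩ := exists_signal_eq (T := T) <| (continuousOn_dotProduct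
    (continuousOn_ofLp h.continuousOn_θhat) h.plant.continuousOn).fun_add hkr
  obtain ⟨w, hw⟩ := exists_signal_eq (T := T) <| hkr.fun_add
    (continuousOn_dotProduct (continuousOn_ofLp hθ) href.plant.continuousOn)
  have hSW : S - W = v - w := by
    ext s
    simp only [ContinuousMap.sub_apply, hS, hW, hv, hw, dotProduct_sub, WithLp.ofLp_sub,
      sub_dotProduct]
    ring
  have hcontrol : u t - uref t + K ⬝ᵥ (x t - xref t) =
      response C (fun s => (θhat s).ofLp ⬝ᵥ x s + kg A b c K * r s) t -
        response C (fun s => kg A b c K * r s + (θ s).ofLp ⬝ᵥ xref s) t := by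
    rw [h.control t t.2.1, href.control t t.2.1, dotProduct_sub]
    ring
  rw [hSW, map_sub, ContinuousMap.sub_apply, hcontrol,
    ← transferOp_apply ⟨C, hC⟩ (f := fun s => (θhat s).ofLp ⬝ᵥ x s + kg A b c K * r s) hv,
    ← transferOp_apply ⟨C, hC⟩ (f := fun s => kg A b c K * r s + (θ s).ofLp ⬝ᵥ xref s) hw]

theorem exists_error_signals (h : IsAdaptiveLoop A b c K C Θ P Γc r x₀ θhat₀ θ x u xhat θhat)
    (href : IsPlant A b x₀ θ xref uref) (hθ : ContinuousOn θ (Set.Ici 0)) :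
    ∃ S W : Signal T, (∀ t, S t = (θ t).ofLp ⬝ᵥ (x t - xref t)) ∧
      ∀ t, W t = -((θhat t - θ t).ofLp ⬝ᵥ x t) := by
  obtain ⟨S, hS⟩ := exists_signal_eq (T := T) <| continuousOn_dotProduct (continuousOn_ofLp hθ)
    (h.plant.continuousOn.sub href.continuousOn)
  obtain ⟨W, hW⟩ := exists_signal_eq (T := T) <| (continuousOn_dotProduct
    (continuousOn_ofLp (h.continuousOn_θhat.sub hθ)) h.plant.continuousOn).fun_neg
  exact ⟨S, W, hS, hW⟩

theorem state_sub_eq (h : IsAdaptiveLoop A b c K C Θ P Γc r x₀ θhat₀ θ x u xhat θhat)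
    (href : IsReferenceLoop A b c K C r x₀ θ xref uref) (hC : C ∈ properTransfer)
    (hr : ContinuousOn r (Set.Ici 0)) (hθ : ContinuousOn θ (Set.Ici 0)) (i : Fin n) {t : ℝ}
    (ht : 0 ≤ t) : x t i - xref t i =
      response (Gbar A b K C i 0) (fun s => (θ s).ofLp ⬝ᵥ (x s - xref s)) t -
        response C (fun s => xhat s i - x s i) t := by
  lift t to ℝ≥0 using ht
  obtain ⟨S, W, hS, hW⟩ := h.exists_error_signals (T := t) href.plant hθ
  have hstate := h.plant.sub_eq_stateSignal href.plant hS
    (fun s => (h.control_sub_eq_transferOp href hC hr hθ hS hW s).symm) i ⟨t, t.2, le_rfl⟩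
  rw [stateSignal_transferOp_sub, ContinuousMap.sub_apply] at hstate
  rwa [transferOp_apply _ (f := fun s => (θ s).ofLp ⬝ᵥ (x s - xref s)) hS,
    transferOp_apply _ (f := fun s => xhat s i - x s i) (h.stateSignal_eq hW i)] at hstate

theorem control_sub_eq (h : IsAdaptiveLoop A b c K C Θ P Γc r x₀ θhat₀ θ x u xhat θhat)
    (href : IsReferenceLoop A b c K C r x₀ θ xref uref) (hC : StrictlyProper C)
    (hr : ContinuousOn r (Set.Ici 0)) (hθ : ContinuousOn θ (Set.Ici 0)) {v : Fin n → ℝ}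
    (hv : IsMinPhaseOutput A b K v) {t : ℝ} (ht : 0 ≤ t) : u t - uref t =
      response C (fun s => (θ s).ofLp ⬝ᵥ (x s - xref s)) t -
        ∑ j, response (filteredInverse A b K C v 0 j) (fun s => xhat s j - x s j) t -
        K ⬝ᵥ (x t - xref t) := by
  lift t to ℝ≥0 using ht
  obtain ⟨S, W, hS, hW⟩ := h.exists_error_signals (T := t) href.plant hθ
  have hcontrol := h.control_sub_eq_transferOp href hC.mem_properTransfer hr hθ hS hW
    ⟨t, t.2, le_rfl⟩
  rw [map_sub, transferOp_eq_sum_filteredInverse (W := W) hC hv, ContinuousMap.sub_apply,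
    ContinuousMap.sum_apply] at hcontrol
  simp only [transferOp_apply _ (f := fun s => (θ s).ofLp ⬝ᵥ (x s - xref s)) hS,
    fun G j => transferOp_apply G (f := fun s => xhat s j - x s j) (h.stateSignal_eq hW j)]
    at hcontrol
  exact eq_sub_of_add_eq hcontrol

theorem norm_state_sub_le_of_forall_le
    (h : IsAdaptiveLoop A b c K C Θ P Γc r x₀ θhat₀ θ x u xhat θhat)
    (href : IsReferenceLoop A b c K C r x₀ θ xref uref) (hK : IsHurwitz (Am A b K))
    (hC : C ∈ properTransfer) (hCs : Stable C) (hΘ : IsCompact Θ)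
    (hr : ContinuousOn r (Set.Ici 0)) (hθ : ContinuousOn θ (Set.Ici 0))
    (hθmem : ∀ t, 0 ≤ t → θ t ∈ Θ) {ρ M t : ℝ} (hρ : ∀ s, 0 ≤ s → ‖xhat s - x s‖ ≤ ρ)
    (ht : 0 ≤ t) (hM : ∀ s ∈ Set.Icc 0 t, ‖x s - xref s‖ ≤ M) :
    ‖x t - xref t‖ ≤ l1GainMat (Gbar A b K C) * (thetaMax Θ * M) + l1Gain C * ρ := by
  have hρ0 : 0 ≤ ρ := (norm_nonneg _).trans (hρ 0 le_rfl)
  have hM0 : 0 ≤ M := (norm_nonneg _).trans (hM t ⟨ht, le_rfl⟩)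
  have hθe : ∀ s ∈ Set.Icc 0 t,
      ‖fun _ : Fin 1 => (θ s).ofLp ⬝ᵥ (x s - xref s)‖ ≤ thetaMax Θ * M := fun s hs =>
    (pi_norm_const _).trans_le <| (abs_dotProduct_le_thetaMax_mul_norm hΘ (hθmem s hs.1) _).trans
      (mul_le_mul_of_nonneg_left (hM s hs) (thetaMax_nonneg Θ))
  refine (pi_norm_le_iff_of_nonneg (add_nonneg (mul_nonneg (l1GainMat_nonneg _)
    (mul_nonneg (thetaMax_nonneg Θ) hM0)) (mul_nonneg (l1Gain_nonneg C) hρ0))).mpr fun i => ?_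
  rw [Pi.sub_apply, h.state_sub_eq href hC hr hθ i ht, Real.norm_eq_abs]
  refine (abs_sub _ _).trans (add_le_add ?_ ?_)
  · simpa only [Finset.univ_unique, Finset.sum_singleton, Fin.default_eq_zero] using
      abs_sum_response_le (Gbar_mem_properTransfer hC i) (stable_Gbar hK hCs i) ht hθe
  · exact abs_response_le hC hCs ht fun s hs =>
      (norm_le_pi_norm (xhat s - x s) i).trans (hρ s hs.1)

theorem norm_state_sub_le (h : IsAdaptiveLoop A b c K C Θ P Γc r x₀ θhat₀ θ x u xhat θhat)
    (href : IsReferenceLoop A b c K C r x₀ θ xref uref) (hK : IsHurwitz (Am A b K))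
    (hC : C ∈ properTransfer) (hCs : Stable C) (hΘ : IsCompact Θ)
    (hgain : l1GainMat (Gbar A b K C) * thetaMax Θ < 1)
    (hr : ContinuousOn r (Set.Ici 0)) (hθ : ContinuousOn θ (Set.Ici 0))
    (hθmem : ∀ t, 0 ≤ t → θ t ∈ Θ) {ρ t : ℝ} (hρ : ∀ s, 0 ≤ s → ‖xhat s - x s‖ ≤ ρ)
    (ht : 0 ≤ t) :
    ‖x t - xref t‖ ≤ l1Gain C / (1 - l1GainMat (HoOneSub A b K C) * thetaMax Θ) * ρ := by
  have hcont : ContinuousOn (fun s => ‖x s - xref s‖) (Set.Icc 0 t) :=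
    (h.plant.continuousOn.sub href.plant.continuousOn).norm.mono Set.Icc_subset_Ici_self
  obtain ⟨s, hs, hmax⟩ := isCompact_Icc.exists_isMaxOn ⟨t, ht, le_rfl⟩ hcont
  have hbound := h.norm_state_sub_le_of_forall_le href hK hC hCs hΘ hr hθ hθmem hρ hs.1
    fun τ hτ => hmax ⟨hτ.1, hτ.2.trans hs.2⟩
  refine (hmax ⟨ht, le_rfl⟩).trans ?_
  rw [l1GainMat_HoOneSub hC, div_mul_eq_mul_div, le_div_iff₀ (sub_pos.mpr hgain)]
  linarith

theorem abs_control_sub_le (h : IsAdaptiveLoop A b c K C Θ P Γc r x₀ θhat₀ θ x u xhat θhat)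
    (href : IsReferenceLoop A b c K C r x₀ θ xref uref) (hC : StrictlyProper C) (hCs : Stable C)
    (hΘ : IsCompact Θ) (hr : ContinuousOn r (Set.Ici 0)) (hθ : ContinuousOn θ (Set.Ici 0))
    (hθmem : ∀ t, 0 ≤ t → θ t ∈ Θ) {ρ γ t : ℝ} (hρ : ∀ s, 0 ≤ s → ‖xhat s - x s‖ ≤ ρ)
    (hγ : ∀ s, 0 ≤ s → ‖x s - xref s‖ ≤ γ) {v : Fin n → ℝ} (hv : IsMinPhaseOutput A b K v)
    (ht : 0 ≤ t) :
    |u t - uref t| ≤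
      l1GainMat (filteredInverse A b K C v) * ρ + ((∑ i, |K i|) + l1Gain C * thetaMax Θ) * γ := by
  have hfilter : |response C (fun s => (θ s).ofLp ⬝ᵥ (x s - xref s)) t| ≤
      l1Gain C * (thetaMax Θ * γ) :=
    abs_response_le hC.mem_properTransfer hCs ht fun s hs =>
      (abs_dotProduct_le_thetaMax_mul_norm hΘ (hθmem s hs.1) _).trans
        (mul_le_mul_of_nonneg_left (hγ s hs.1) (thetaMax_nonneg Θ))
  have hinverse : |∑ j, response (filteredInverse A b K C v 0 j) (fun s => xhat s j - x s j) t| ≤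
      l1GainMat (filteredInverse A b K C v) * ρ :=
    abs_sum_response_le (v := fun s => xhat s - x s)
      (filteredInverse_mem_properTransfer hC hv 0) (stable_filteredInverse hCs hv 0) ht
      fun s hs => hρ s hs.1
  have hfeedback : |K ⬝ᵥ (x t - xref t)| ≤ (∑ i, |K i|) * γ :=
    (abs_dotProduct_le_sum_abs_mul_norm _ _).trans
      (mul_le_mul_of_nonneg_left (hγ t ht) (Finset.sum_nonneg fun _ _ => abs_nonneg _))
  rw [h.control_sub_eq href hC hr hθ hv ht]
  calc _ ≤ l1Gain C * (thetaMax Θ * γ) + l1GainMat (filteredInverse A b K C v) * ρ +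
        (∑ i, |K i|) * γ :=
      (abs_sub _ _).trans (add_le_add ((abs_sub _ _).trans (add_le_add hfilter hinverse)) hfeedback)
    _ = _ := by ring

end IsAdaptiveLoop

end Loops

end L1Adaptive

end

theorem theorem4_general {n : ℕ} (hn : 0 < n)
    (A : Matrix (Fin n) (Fin n) ℝ) (b c K : Fin n → ℝ)
    (hctrl : L1Adaptive.IsControllable A b)
    (hK : L1Adaptive.IsHurwitz (L1Adaptive.Am A b K))
    (C : RatFunc ℝ) (hCproper : L1Adaptive.StrictlyProper C) (hCstable : L1Adaptive.Stable C)
    (P Q : Matrix (Fin n) (Fin n) ℝ) (hQ : Q.PosDef)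
    (hP : (L1Adaptive.Am A b K)ᵀ * P + P * L1Adaptive.Am A b K = -Q)
    (Γc : ℝ) (hΓc : 0 < Γc)
    (Θ : Set (EuclideanSpace ℝ (Fin n))) (hΘcompact : IsCompact Θ) (hΘconvex : Convex ℝ Θ)
    (hgain : L1Adaptive.l1GainMat (L1Adaptive.Gbar A b K C) * L1Adaptive.thetaMax Θ < 1)
    (r : ℝ → ℝ) (hrcont : ContinuousOn r (Set.Ici 0))
    (x₀ : Fin n → ℝ) (θhat₀ : EuclideanSpace ℝ (Fin n)) (hθhat₀ : θhat₀ ∈ Θ)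
    (θ : ℝ → EuclideanSpace ℝ (Fin n)) (dθ : ℝ≥0)
    (hθmem : ∀ t, 0 ≤ t → θ t ∈ Θ)
    (hθlip : LipschitzOnWith dθ θ (Set.Ici 0))
    (x : ℝ → Fin n → ℝ) (u : ℝ → ℝ) (xhat : ℝ → Fin n → ℝ)
    (θhat : ℝ → EuclideanSpace ℝ (Fin n))
    (hloop : L1Adaptive.IsAdaptiveLoop A b c K C Θ P Γc r x₀ θhat₀ θ x u xhat θhat)
    (xref : ℝ → Fin n → ℝ) (uref : ℝ → ℝ)
    (href : L1Adaptive.IsReferenceLoop A b c K C r x₀ θ xref uref) :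
    L1Adaptive.linftyNorm (fun t => x t - xref t) ≤
        ENNReal.ofReal (L1Adaptive.gamma3 A b K C Θ P Q Γc dθ) ∧
      (∃ co : Fin n → ℝ, L1Adaptive.IsMinPhaseOutput A b K co) ∧
      ∀ co : Fin n → ℝ, L1Adaptive.IsMinPhaseOutput A b K co →
        L1Adaptive.linftyNorm (fun t => u t - uref t) ≤
          ENNReal.ofReal (L1Adaptive.gamma4 A b K C Θ P Q Γc dθ co) := by
  have hpredictor : ∀ t, 0 ≤ t →
      ‖xhat t - x t‖ ≤ √(L1Adaptive.thetaM Θ P Q dθ / (L1Adaptive.lamMin P * Γc)) := fun _ =>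
    hloop.norm_sub_le hn hΓc hK hQ hP hΘcompact hΘconvex hθhat₀ hθmem hθlip
  have hstate : ∀ t, 0 ≤ t → ‖x t - xref t‖ ≤ L1Adaptive.gamma3 A b K C Θ P Q Γc dθ := fun _ =>
    hloop.norm_state_sub_le href hK hCproper.mem_properTransfer hCstable hΘcompact hgain hrcont
      hθlip.continuousOn hθmem hpredictor
  exact ⟨L1Adaptive.linftyNorm_le hstate, L1Adaptive.exists_isMinPhaseOutput hn hctrl hK,
    fun _ hco => L1Adaptive.linftyNorm_le fun _ => hloop.abs_control_sub_le href hCproper hCstable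
      hΘcompact hrcont hθlip.continuousOn hθmem hpredictor hstate hco⟩

theorem theorem4 {n : ℕ} (hn : 0 < n)
    -- plant data and state feedback
    (A : Matrix (Fin n) (Fin n) ℝ) (b c K : Fin n → ℝ)
    (hctrl : L1Adaptive.IsControllable A b)
    (hK : L1Adaptive.IsHurwitz (L1Adaptive.Am A b K))
    -- the low-pass filter
    (C : RatFunc ℝ) (hCproper : L1Adaptive.StrictlyProper C) (hCstable : L1Adaptive.Stable C)
    (hC0 : RatFunc.eval (RingHom.id ℝ) 0 C = 1)
    -- the adaptive law
    (P Q : Matrix (Fin n) (Fin n) ℝ) (hQ : Q.PosDef)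
    (hP : (L1Adaptive.Am A b K)ᵀ * P + P * L1Adaptive.Am A b K = -Q)
    (Γc : ℝ) (hΓc : 0 < Γc)
    (Θ : Set (EuclideanSpace ℝ (Fin n))) (hΘcompact : IsCompact Θ) (hΘconvex : Convex ℝ Θ)
    -- the gain requirement
    (hgain : L1Adaptive.l1GainMat (L1Adaptive.Gbar A b K C) * L1Adaptive.thetaMax Θ < 1)
    -- the reference signal and the initial values
    (r : ℝ → ℝ) (hrcont : ContinuousOn r (Set.Ici 0))
    (hrbdd : ∃ R : ℝ, ∀ t, 0 ≤ t → |r t| ≤ R)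
    (x₀ : Fin n → ℝ) (θhat₀ : EuclideanSpace ℝ (Fin n)) (hθhat₀ : θhat₀ ∈ Θ)
    -- the time-varying unknown parameter
    (θ : ℝ → EuclideanSpace ℝ (Fin n)) (dθ : ℝ)
    (hθmem : ∀ t, 0 ≤ t → θ t ∈ Θ)
    (hθdiff : ContDiffOn ℝ 1 θ (Set.Ici 0))
    (hθderiv : ∀ t, 0 ≤ t → ‖derivWithin θ (Set.Ici 0) t‖ ≤ dθ)
    -- the signals of the adaptive closed loop and of the reference closed loop
    (x : ℝ → Fin n → ℝ) (u : ℝ → ℝ) (xhat : ℝ → Fin n → ℝ)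
    (θhat : ℝ → EuclideanSpace ℝ (Fin n))
    (hloop : L1Adaptive.IsAdaptiveLoop A b c K C Θ P Γc r x₀ θhat₀ θ x u xhat θhat)
    (xref : ℝ → Fin n → ℝ) (uref : ℝ → ℝ)
    (href : L1Adaptive.IsReferenceLoop A b c K C r x₀ θ xref uref) :
    L1Adaptive.linftyNorm (fun t => x t - xref t) ≤
        ENNReal.ofReal (L1Adaptive.gamma3 A b K C Θ P Q Γc dθ) ∧
      (∃ co : Fin n → ℝ, L1Adaptive.IsMinPhaseOutput A b K co) ∧
      ∀ co : Fin n → ℝ, L1Adaptive.IsMinPhaseOutput A b K co →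
        L1Adaptive.linftyNorm (fun t => u t - uref t) ≤
          ENNReal.ofReal (L1Adaptive.gamma4 A b K C Θ P Q Γc dθ co) := by
  lift dθ to ℝ≥0 using (norm_nonneg _).trans (hθderiv 0 le_rfl)
  exact theorem4_general hn A b c K hctrl hK C hCproper hCstable P Q hQ hP Γc hΓc Θ hΘcompact
    hΘconvex hgain r hrcont x₀ θhat₀ hθhat₀ θ dθ hθmem
    ((convex_Ici 0).lipschitzOnWith_of_nnnorm_derivWithin_le
      (hθdiff.differentiableOn one_ne_zero) hθderiv) x u xhat θhat hloop xref uref href
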